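/- Let $\Omega=(a,b)$ with $a<b$, let $n\ge 1$ be an integer, $h=(b-a)/n$, and let the horizon be $\delta=h$. Put $\mathcal B=[a-\delta,a]\cup[b,b+\delta]$, $\widehat\Omega=\Omega\cup\mathcal B=[a-\delta,b+\delta]$, $\gamma(x,y)=\delta^{-3}\mathbf 1_{\{|y-x|<\delta\}}$, and $$D(u,v)=\int_{\widehat\Omega}\int_{\widehat\Omega}(v(y)-v(x))\,\gamma(x,y)\,(u(y)-u(x))\,dy\,dx .$$ Let $\mathcal V=\{w\in L^2(\widehat\Omega):D(w,w)<\infty\}$ and $\mathcal V_0=\{w\in\mathcal V: w=0\text{ on }\mathcal B\}$. Given $f\in L^2(\Omega)$ and a continuous $g:\mathcal B\to\mathbb R$, let $u\in\mathcal V$ be a weak solution of the nonlocal Poisson problem: $u=g$ a.e. on $\mathcal B$ and $D(u,v)=\int_\Omega vf\,dx$ for all $v\in\mathcal V_0$. Let $\mathcal V^h$ be the space of continuous functions on $\widehat\Omega$ that are piecewise linear on the uniform grid with nodes $a+jh$, $-1\le j\le n+1$, and let $\mathcal V^h_0\subset\mathcal V^h$ be spanned by the hat functions of the nodes in $\Omega$.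 Fix an integer $N\ge1$. For $x\in\widehat\Omega$ and $k\in\{-N,\dots,N\}\setminus\{0\}$ let $x_k=x+(2k-\operatorname{sgn}k)\frac{\delta}{2N}$, and let $(\omega_k(x))_k$ be the GMLS weights, i.e. the minimizer of $\sum_k\omega_k^2$ subject to $$\sum_k\gamma(x,x_k)(x_k-x)^2\omega_k=\int_{x-\delta}^{x+\delta}\gamma(x,y)(y-x)^2\,dy .$$ With exact outer integration, set $$D^h(u,v)=\int_{\widehat\Omega}\ \sum_{k:\,x_k\in\widehat\Omega}(v(x_k)-v(x))\,\gamma(x,x_k)\,(u(x_k)-u(x))\,\omega_k(x)\,dx .$$ Let $u^h\in\mathcal V^h$ be the finite element solution: $u^h=g$ at the nodes in $\mathcal B$, and $D^h(u^h,v^h)=\int_\Omega v^hf\,dx$ for all $v^h\in\mathcal V^h_0$. If $u\in H^2(a-\delta,b+\delta)$, then $u-u^h\in H^1(a-\delta,b+\delta)$ and $$\|u-u^h\|_{H^1(a-\delta,b+\delta)}\le C\,\|u\|_{H^2(a-\delta,b+\delta)}\,h ,$$ where $C>0$ depends only on $a$, $b$ and $N$; in particular it does not depend on $h$, $\delta$,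 $f$, $g$ or $u$. -/

import Mathlib

open MeasureTheory Set
open scoped ContDiff

noncomputable section

namespace NonlocalFEM

/-! ### One-dimensional Sobolev spaces through weak derivatives -/

/-- `f'` is a weak derivative of `f` on the open set `s ⊆ ℝ`. -/
structure HasWeakDeriv (s : Set ℝ) (f f' : ℝ → ℝ) : Prop where
  locallyIntegrable : LocallyIntegrableOn f s
  locallyIntegrable_deriv : LocallyIntegrableOn f' s
  integral_eq : ∀ φ : ℝ → ℝ, ContDiff ℝ ∞ φ → HasCompactSupport φ → tsupport φ ⊆ s →
    ∫ x in s, f x * deriv φ x = - ∫ x in s, f' x * φ x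

/-- A chosen weak derivative (unique up to null sets, when there is one). -/
def weakDeriv (s : Set ℝ) (f : ℝ → ℝ) : ℝ → ℝ :=
  Classical.epsilon (HasWeakDeriv s f)

/-- `f ∈ H¹(s)`. -/
def MemH1 (s : Set ℝ) (f : ℝ → ℝ) : Prop :=
  MemLp f 2 (volume.restrict s) ∧
    ∃ f' : ℝ → ℝ, HasWeakDeriv s f f' ∧ MemLp f' 2 (volume.restrict s)

/-- `f ∈ H²(s)`. -/
def MemH2 (s : Set ℝ) (f : ℝ → ℝ) : Prop :=
  MemLp f 2 (volume.restrict s) ∧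
    ∃ f' f'' : ℝ → ℝ, HasWeakDeriv s f f' ∧ MemLp f' 2 (volume.restrict s) ∧
      HasWeakDeriv s f' f'' ∧ MemLp f'' 2 (volume.restrict s)

/-- `‖f‖_{H¹(s)}`, for `f ∈ H¹(s)`. -/
def normH1 (s : Set ℝ) (f : ℝ → ℝ) : ℝ :=
  Real.sqrt ((∫ x in s, f x ^ 2) + ∫ x in s, weakDeriv s f x ^ 2)

/-- `‖f‖_{H²(s)}`, for `f ∈ H²(s)`. -/
def normH2 (s : Set ℝ) (f : ℝ → ℝ) : ℝ :=
  Real.sqrt ((∫ x in s, f x ^ 2) + (∫ x in s, weakDeriv s f x ^ 2)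
    + ∫ x in s, weakDeriv s (weakDeriv s f) x ^ 2)

/-! ### The nonlocal problem on `Ω = (a, b)` with horizon `δ` -/

/-- The constant kernel `γ(x, y) = δ⁻³ 1_{|y - x| < δ}`. -/
def kernel (δ x y : ℝ) : ℝ := if |y - x| < δ then 1 / δ ^ 3 else 0

/-- The interaction domain of `Ω = (a, b)`. -/
def interaction (a b δ : ℝ) : Set ℝ := Icc (a - δ) a ∪ Icc b (b + δ)

/-- The union of `Ω = (a, b)` and its interaction domain. -/
def wholeDomain (a b δ : ℝ) : Set ℝ := Icc (a - δ) (b + δ)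

/-- The nonlocal bilinear form `D(u, v)`. -/
def formD (a b δ : ℝ) (u v : ℝ → ℝ) : ℝ :=
  ∫ x in wholeDomain a b δ, ∫ y in wholeDomain a b δ,
    (v y - v x) * kernel δ x y * (u y - u x)

/-- The load functional `G(v) = ∫_Ω v f`. -/
def load (a b : ℝ) (f v : ℝ → ℝ) : ℝ := ∫ x in Ioo a b, v x * f x

/-- The energy space: square-integrable functions on the whole domain with finite energy
`D(w, w)`. -/
def MemV (a b δ : ℝ) (w : ℝ → ℝ) : Prop :=
  MemLp w 2 (volume.restrict (wholeDomain a b δ)) ∧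
    Integrable (fun p : ℝ × ℝ => (w p.2 - w p.1) ^ 2 * kernel δ p.1 p.2)
      ((volume.restrict (wholeDomain a b δ)).prod (volume.restrict (wholeDomain a b δ)))

/-- The constrained energy space: functions of the energy space that vanish (almost everywhere)
on the interaction domain. -/
def MemV0 (a b δ : ℝ) (w : ℝ → ℝ) : Prop :=
  MemV a b δ w ∧ ∀ᵐ x ∂(volume.restrict (interaction a b δ)), w x = 0

/-- `u` is a weak solution of the nonlocal Poisson problem with right-hand side `f` on `Ω` and
Dirichlet volume constraint `u = g` on the interaction domain. -/
structure IsNonlocalSolution (a b δ : ℝ) (f g u : ℝ → ℝ) : Prop where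
  memV : MemV a b δ u
  constraint : ∀ᵐ x ∂(volume.restrict (interaction a b δ)), u x = g x
  weak_eq : ∀ v : ℝ → ℝ, MemV0 a b δ v → formD a b δ u v = load a b f v

/-! ### Inner quadrature by generalized moving least squares -/

/-- The indices `k ∈ {-N, …, N} \ {0}` of the inner quadrature points. -/
def quadIdx (N : ℕ) : Finset ℤ := (Finset.Icc (-(N : ℤ)) (N : ℤ)).erase 0

/-- The inner quadrature point `x + (2k - sgn k) h̄ / 2`, with spacing `h̄ = δ / N`. -/
def quadPoint (δ : ℝ) (N : ℕ) (x : ℝ) (k : ℤ) : ℝ :=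
  x + (2 * (k : ℝ) - (Int.sign k : ℝ)) * ((δ / (N : ℝ)) / 2)

/-- Exactness, over the full ball around `x`, on the space of integrands that is spanned by
`y ↦ γ(x, y) (y - x)²`. -/
def QuadExact (δ : ℝ) (N : ℕ) (x : ℝ) (wt : ℤ → ℝ) : Prop :=
  ∑ k ∈ quadIdx N, kernel δ x (quadPoint δ N x k) * (quadPoint δ N x k - x) ^ 2 * wt k
    = ∫ y in Icc (x - δ) (x + δ), kernel δ x y * (y - x) ^ 2

/-- `wt` is a family of GMLS weights for the ball around `x`: it minimizes the sum of the squared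
weights among the families that satisfy the exactness constraint. -/
def IsGMLSWeights (δ : ℝ) (N : ℕ) (x : ℝ) (wt : ℤ → ℝ) : Prop :=
  QuadExact δ N x wt ∧
    ∀ wt' : ℤ → ℝ, QuadExact δ N x wt' → ∑ k ∈ quadIdx N, wt k ^ 2 ≤ ∑ k ∈ quadIdx N, wt' k ^ 2

open Classical in
/-- The bilinear form `Dʰ(u, v)`: exact outer integral, inner quadrature with the weights `wt x` at
those quadrature points that lie in the whole domain. -/
def formDh (a b δ : ℝ) (N : ℕ) (wt : ℝ → ℤ → ℝ) (u v : ℝ → ℝ) : ℝ :=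
  ∫ x in wholeDomain a b δ,
    ∑ k ∈ (quadIdx N).filter (fun k => quadPoint δ N x k ∈ wholeDomain a b δ),
      (v (quadPoint δ N x k) - v x) * kernel δ x (quadPoint δ N x k)
        * (u (quadPoint δ N x k) - u x) * wt x k

/-! ### Piecewise linear finite elements on a uniform grid -/

/-- The grid point `a + j h`. -/
def node (a h : ℝ) (j : ℤ) : ℝ := a + (j : ℝ) * h

/-- The hat function of the grid point `a + j h`. -/
def hat (a h : ℝ) (j : ℤ) (x : ℝ) : ℝ := max 0 (1 - |x - node a h j| / h)

/-- `𝒱ʰ`: the span of the hat functions of all nodes in the whole domain. -/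
def spaceVh (a b δ h : ℝ) : Submodule ℝ (ℝ → ℝ) :=
  Submodule.span ℝ {ψ | ∃ j : ℤ, node a h j ∈ wholeDomain a b δ ∧ ψ = hat a h j}

/-- `𝒱ʰ₀`: the span of the hat functions of the nodes in the open interval `Ω = (a, b)`. -/
def spaceVh0 (a b h : ℝ) : Submodule ℝ (ℝ → ℝ) :=
  Submodule.span ℝ {ψ | ∃ j : ℤ, node a h j ∈ Ioo a b ∧ ψ = hat a h j}

/-- `uh` is the fully discrete finite element solution: it lies in `𝒱ʰ`, takes the values of `g` at
the nodes of the interaction domain, and satisfies the discrete variational equation, in which the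
load is integrated exactly. -/
structure IsDiscreteSolution (a b δ h : ℝ) (N : ℕ) (wt : ℝ → ℤ → ℝ) (f g uh : ℝ → ℝ) : Prop where
  mem : uh ∈ spaceVh a b δ h
  constraint : ∀ j : ℤ, node a h j ∈ interaction a b δ → uh (node a h j) = g (node a h j)
  discrete_eq : ∀ v ∈ spaceVh0 a b h, formDh a b δ N wt uh v = load a b f v

end NonlocalFEM

end

/-!
The error estimate rests on comparing both bilinear forms with the local form `(2/3) ∫ u' v'`.
For an interaction distance `z` put `T_z(v, e) = ∫ (v(x+z) - v(x)) (e(x+z) - e(x)) dx`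
(`diffForm`). If `e` vanishes outside `Ω`, the truncation to the whole domain is invisible, and
`D(v, e)` is the integral of `δ⁻³ T_z(v, e)` over `|z| < δ` (`formD_eq_integral_diffForm`). The GMLS
weights have the closed form `gmlsWeight`: they are nonnegative and do not depend on `x`, so that
`Dʰ(v, e)` is a sum `∑ c_k T_{r_k}(v, e)` with `c_k ≥ 0` and `∑ c_k r_k² = 2/3`
(`formDh_eq_sum_diffForm`, `sum_quadCoeff_mul_sq`).

Three facts about a single shift carry the proof.
* Consistency (`abs_diffForm_sub_le`): `T_z(u, e) = z² ∫ u' e' + O(|z|³ ‖u''‖ ‖e'‖)`. Summation by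
  parts moves both differences onto `u`, and the second difference of a primitive of `u` is
  `z² u'` up to the oscillation of `u'` on a ball of radius `|z|`.
* Boundedness (`abs_diffForm_le`): `|T_z(w, e)| ≤ 4 z² ‖w'‖ ‖e'‖`.
* Coercivity (`IsPiecewiseAffine.mul_integral_deriv_sq_le`): if `e` is piecewise affine, then
  `T_z(e, e) ≥ z² (1 - |z|/h) ‖e'‖²`, from pairs of points in a common cell. All displacements
  satisfy `|r_k| ≤ (1 - 1/(2N)) δ`, so `Dʰ(e, e) ≥ ‖e'‖² / (3N)`.

The `L²` bounds for differences come from `integral_sq_movingIntegral_le`. Let `v` be the nodal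
interpolant of `u` and `e = v - uʰ`, an element of `𝒱ʰ₀`. The two variational equations give
`Dʰ(e, e) = Dʰ(v, e) - D(u, e)`, which is `O(h ‖u''‖ ‖e'‖)` by consistency and boundedness, because
`‖(u - v)'‖ ≤ h ‖u''‖`. Coercivity then bounds `‖e'‖` (`energy_estimate`), and the Poincaré
inequality on the whole domain, at whose left end the error vanishes, bounds the `L²` norm.

Sobolev functions are handled through `IsPrimitive`: by the lemma of du Bois-Reymond
(`HasWeakDeriv.exists_ae_eq_const`) a function in `H²` of an interval has a `C¹` representative
whose derivative is a primitive of the second weak derivative (`MemH2.exists_representative`).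
-/

noncomputable section

namespace NonlocalFEM

/-! ### Primitives of locally integrable functions -/

/-- `F` is a primitive of `f` on the whole line, in the sense of the Lebesgue integral: `F` is
locally absolutely continuous and `F' = f` almost everywhere. -/
structure IsPrimitive (f F : ℝ → ℝ) : Prop where
  intervalIntegrable : ∀ x y, IntervalIntegrable f volume x y
  integral_eq : ∀ x y, ∫ t in x..y, f t = F y - F x

namespace IsPrimitive

variable {f F g G : ℝ → ℝ}

theorem sub (hF : IsPrimitive f F) (hG : IsPrimitive g G) :
    IsPrimitive (fun x => f x - g x) (fun x => F x - G x) := by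
  refine ⟨fun x y => (hF.1 x y).sub (hG.1 x y), fun x y => ?_⟩
  rw [intervalIntegral.integral_sub (hF.1 x y) (hG.1 x y), hF.2, hG.2]
  ring

theorem of_integral (hf : ∀ x y, IntervalIntegrable f volume x y) (A c : ℝ) :
    IsPrimitive f (fun x => c + ∫ t in A..x, f t) := by
  refine ⟨hf, fun x y => ?_⟩
  rw [add_sub_add_left_eq_sub, intervalIntegral.integral_interval_sub_left (hf _ _) (hf _ _)]

theorem of_hasDerivAt (hF : ∀ x, HasDerivAt F (f x) x) (hf : Continuous f) : IsPrimitive f F :=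
  ⟨fun x y => hf.intervalIntegrable x y, fun x y =>
    intervalIntegral.integral_eq_sub_of_hasDerivAt (fun t _ => hF t) (hf.intervalIntegrable x y)⟩

theorem of_lipschitz {K : NNReal} (hF : LipschitzWith K F) : IsPrimitive (deriv F) F := by
  have hac : ∀ x y, AbsolutelyContinuousOnInterval F x y := fun x y =>
    (hF.lipschitzOnWith (s := uIcc x y)).absolutelyContinuousOnInterval
  exact ⟨fun x y => (hac x y).intervalIntegrable_deriv, fun x y => (hac x y).integral_deriv_eq_sub⟩

theorem eq_add (hF : IsPrimitive f F) (A : ℝ) : F = fun x => F A + ∫ t in A..x, f t := by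
  funext x
  rw [hF.2]
  ring

theorem absolutelyContinuous (hF : IsPrimitive f F) (x y : ℝ) :
    AbsolutelyContinuousOnInterval F x y := by
  have h1 := (hF.1 x y).absolutelyContinuousOnInterval_intervalIntegral (c := x) (by simp)
  have h2 : AbsolutelyContinuousOnInterval (fun _ : ℝ => F x) x y :=
    ((LipschitzWith.const (F x)).lipschitzOnWith (s := uIcc x y)).absolutelyContinuousOnInterval
  rw [hF.eq_add x]
  exact h2.fun_add h1

theorem continuous (hF : IsPrimitive f F) : Continuous F := by
  rw [hF.eq_add 0]
  exact continuous_const.add (intervalIntegral.continuous_primitive hF.1 0)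

theorem ae_deriv_eq (hF : IsPrimitive f F) : ∀ᵐ x, deriv F x = f x := by
  have hloc : LocallyIntegrable f volume := by
    rw [locallyIntegrable_iff]
    intro k hk
    obtain ⟨R, hR⟩ := hk.isBounded.subset_closedBall 0
    rw [Real.closedBall_eq_Icc] at hR
    refine IntegrableOn.mono_set ?_ hR
    by_cases hle : 0 - R ≤ 0 + R
    · exact (intervalIntegrable_iff_integrableOn_Icc_of_le hle).1 (hF.1 _ _)
    · rw [Icc_eq_empty hle]; exact integrableOn_empty
  filter_upwards [LocallyIntegrable.ae_hasDerivAt_integral hloc] with x hx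
  rw [hF.eq_add 0]
  exact ((hx 0).const_add _).deriv

/-- Integration by parts. -/
theorem integral_mul_eq (hF : IsPrimitive f F) (hG : IsPrimitive g G) (A B : ℝ) :
    ∫ x in A..B, F x * g x = F B * G B - F A * G A - ∫ x in A..B, f x * G x := by
  have h := (hF.absolutelyContinuous A B).integral_mul_deriv_eq_deriv_mul
    (hG.absolutelyContinuous A B)
  rw [intervalIntegral.integral_congr_ae (g := fun x => F x * g x)
    (hG.ae_deriv_eq.mono fun x hx _ => by simp only [hx])] at h
  rw [h, intervalIntegral.integral_congr_ae (f := fun x => deriv F x * G x)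
    (g := fun x => f x * G x) (hF.ae_deriv_eq.mono fun x hx _ => by simp only [hx])]

end IsPrimitive

/-! ### Square-integrable functions and moving integrals -/

/-- The Cauchy–Schwarz inequality. -/
theorem abs_integral_mul_le {α : Type*} [MeasurableSpace α] {μ : Measure α} {f g : α → ℝ}
    (hf : MemLp f 2 μ) (hg : MemLp g 2 μ) :
    |∫ x, f x * g x ∂μ| ≤ √(∫ x, f x ^ 2 ∂μ) * √(∫ x, g x ^ 2 ∂μ) := by
  have h2 : ENNReal.ofReal 2 = 2 := by simp
  have h := integral_mul_le_Lp_mul_Lq_of_nonneg (μ := μ) Real.HolderConjugate.two_two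
    (f := fun x => |f x|) (g := fun x => |g x|) (.of_forall fun x => abs_nonneg _)
    (.of_forall fun x => abs_nonneg _) (by rw [h2]; exact hf.abs) (by rw [h2]; exact hg.abs)
  simp only [Real.rpow_two, sq_abs, ← Real.sqrt_eq_rpow, ← abs_mul] at h
  exact abs_integral_le_integral_abs.trans h

theorem abs_intervalIntegral_mul_le {f g : ℝ → ℝ} {A B : ℝ} (hAB : A ≤ B)
    (hf : MemLp f 2 (volume.restrict (Ioc A B))) (hg : MemLp g 2 (volume.restrict (Ioc A B))) :
    |∫ x in A..B, f x * g x| ≤ √(∫ x in A..B, f x ^ 2) * √(∫ x in A..B, g x ^ 2) := by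
  simp only [intervalIntegral.integral_of_le hAB]
  exact abs_integral_mul_le hf hg

theorem sq_intervalIntegral_le {f : ℝ → ℝ} {A B : ℝ} (hAB : A ≤ B)
    (hf : MemLp f 2 (volume.restrict (Ioc A B))) :
    (∫ x in A..B, |f x|) ^ 2 ≤ (B - A) * ∫ x in A..B, f x ^ 2 := by
  have h := abs_intervalIntegral_mul_le hAB (memLp_const (1 : ℝ)) hf.abs
  simp only [one_mul, one_pow, Pi.abs_apply, sq_abs, intervalIntegral.integral_const, smul_eq_mul,
    mul_one] at h
  have h1 := pow_le_pow_left₀ (abs_nonneg _) h 2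
  rwa [sq_abs, mul_pow, Real.sq_sqrt (sub_nonneg.2 hAB), Real.sq_sqrt
    (intervalIntegral.integral_nonneg hAB fun x _ => sq_nonneg _)] at h1

theorem _root_.MeasureTheory.MemLp.intervalIntegrable_sq {f : ℝ → ℝ} (hf : MemLp f 2 volume)
    (x y : ℝ) :
    IntervalIntegrable (fun t => f t ^ 2) volume x y :=
  hf.integrable_sq.intervalIntegrable

theorem _root_.MeasureTheory.MemLp.intervalIntegrable_of_two {f : ℝ → ℝ} (hf : MemLp f 2 volume)
    (x y : ℝ) :
    IntervalIntegrable f volume x y := by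
  rw [intervalIntegrable_iff, uIoc]
  exact (hf.restrict _).integrable (by norm_num)

theorem continuous_movingIntegral {f : ℝ → ℝ} (hf : ∀ x y, IntervalIntegrable f volume x y)
    (r : ℝ) : Continuous fun x => ∫ t in (x - r)..(x + r), f t := by
  have h := intervalIntegral.continuous_primitive hf 0
  have : (fun x => ∫ t in (x - r)..(x + r), f t) =
      fun x => (∫ t in (0:ℝ)..(x + r), f t) - ∫ t in (0:ℝ)..(x - r), f t := by
    funext x
    rw [intervalIntegral.integral_interval_sub_left (hf _ _) (hf _ _)]
  rw [this]
  exact (h.comp (by fun_prop)).sub (h.comp (by fun_prop))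

/-- Moving integrals over balls of radius `r` are of size `O(r)` in `L²`. By Cauchy–Schwarz the
square is at most `2 r (P(x+r) - P(x-r))` for the monotone primitive `P` of `f²`, and the
integral of such a difference is the difference of two integrals of `P` over intervals of length
`2 r`. -/
theorem integral_sq_movingIntegral_le {f : ℝ → ℝ} (hf : MemLp f 2 volume) {r : ℝ} (hr : 0 ≤ r)
    {A B : ℝ} (hAB : A ≤ B) :
    ∫ x in A..B, (∫ t in (x - r)..(x + r), |f t|) ^ 2 ≤ 4 * r ^ 2 * ∫ t, f t ^ 2 := by
  have hi := hf.intervalIntegrable_sq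
  set P : ℝ → ℝ := fun x => ∫ t in (0:ℝ)..x, f t ^ 2 with hP
  have hPc : Continuous P := intervalIntegral.continuous_primitive hi 0
  have hPd : ∀ x y, P y - P x = ∫ t in x..y, f t ^ 2 := fun x y =>
    intervalIntegral.integral_interval_sub_left (hi _ _) (hi _ _)
  have hle : ∀ x y, x ≤ y → P y - P x ≤ ∫ t, f t ^ 2 := fun x y hxy => by
    rw [hPd, intervalIntegral.integral_of_le hxy]
    exact setIntegral_le_integral hf.integrable_sq (.of_forall fun t => sq_nonneg _)
  have hpt : ∀ x, (∫ t in (x - r)..(x + r), |f t|) ^ 2 ≤ 2 * r * (P (x + r) - P (x - r)) := by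
    intro x
    have := sq_intervalIntegral_le (show x - r ≤ x + r by linarith)
      (hf.restrict (Ioc (x - r) (x + r)))
    rw [hPd]
    convert this using 2
    ring
  have hc1 := continuous_movingIntegral (f := fun t => |f t|)
    (fun x y => (hf.intervalIntegrable_of_two x y).abs) r
  have hPr : Continuous fun x => P (x + r) := hPc.comp (by fun_prop)
  have hPl : Continuous fun x => P (x - r) := hPc.comp (by fun_prop)
  have hmono : ∫ x in A..B, (∫ t in (x - r)..(x + r), |f t|) ^ 2 ≤
      ∫ x in A..B, 2 * r * (P (x + r) - P (x - r)) :=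
    intervalIntegral.integral_mono_on hAB ((hc1.pow 2).intervalIntegrable _ _)
      (((hPr.sub hPl).const_mul _).intervalIntegrable _ _) fun x _ => hpt x
  refine hmono.trans ?_
  rw [intervalIntegral.integral_const_mul, intervalIntegral.integral_sub
    (hPr.intervalIntegrable _ _) (hPl.intervalIntegrable _ _),
    intervalIntegral.integral_comp_add_right, intervalIntegral.integral_comp_sub_right,
    intervalIntegral.integral_interval_sub_interval_comm' (hPc.intervalIntegrable _ _)
      (hPc.intervalIntegrable _ _) (hPc.intervalIntegrable _ _)]
  have e1 : ∫ x in (B - r)..(B + r), P x = ∫ s in (-r)..r, P (s + B) := by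
    rw [intervalIntegral.integral_comp_add_right]; congr 1 <;> ring
  have e2 : ∫ x in (A - r)..(A + r), P x = ∫ s in (-r)..r, P (s + A) := by
    rw [intervalIntegral.integral_comp_add_right]; congr 1 <;> ring
  have cB : Continuous fun s => P (s + B) := hPc.comp (by fun_prop)
  have cA : Continuous fun s => P (s + A) := hPc.comp (by fun_prop)
  rw [e1, e2, ← intervalIntegral.integral_sub (cB.intervalIntegrable _ _)
    (cA.intervalIntegrable _ _)]
  have h3 : ∫ s in (-r)..r, (P (s + B) - P (s + A)) ≤ ∫ s in (-r)..r, ∫ t, f t ^ 2 :=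
    intervalIntegral.integral_mono_on (by linarith) ((cB.sub cA).intervalIntegrable _ _)
      (by simp) fun s _ => hle _ _ (by linarith)
  rw [intervalIntegral.integral_const, smul_eq_mul] at h3
  nlinarith [mul_le_mul_of_nonneg_left h3 (show 0 ≤ 2 * r by linarith)]

theorem IsPrimitive.abs_sub_le {f F : ℝ → ℝ} (hF : IsPrimitive f F) {x r s t : ℝ}
    (hs : |s - x| ≤ r) (ht : |t - x| ≤ r) :
    |F t - F s| ≤ ∫ y in (x - r)..(x + r), |f y| := by
  rw [abs_le] at hs ht
  have hr : x - r ≤ x + r := by linarith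
  rw [← hF.2]
  refine (intervalIntegral.norm_integral_le_integral_norm_uIoc (f := f) (μ := volume)).trans ?_
  rw [intervalIntegral.integral_of_le hr]
  refine setIntegral_mono_set ?_ (.of_forall fun y => abs_nonneg _) (LE.le.eventuallyLE ?_)
  · exact (intervalIntegrable_iff_integrableOn_Ioc_of_le hr).1 (hF.1 _ _).abs
  · exact Ioc_subset_Ioc (le_min (by linarith) (by linarith)) (max_le (by linarith) (by linarith))

/-! ### Weak derivatives -/

theorem eq_zero_of_tsupport_subset {φ : ℝ → ℝ} {s : Set ℝ} (h : tsupport φ ⊆ s) {x : ℝ}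
    (hx : x ∉ s) : φ x = 0 :=
  image_eq_zero_of_notMem_tsupport fun h' => hx (h h')

theorem _root_.ContDiff.isPrimitive_deriv {φ : ℝ → ℝ} (h : ContDiff ℝ ∞ φ) :
    IsPrimitive (deriv φ) φ :=
  .of_hasDerivAt (fun x => (h.differentiable (by simp) x).hasDerivAt) (h.continuous_deriv (by simp))

theorem IsPrimitive.hasWeakDeriv {f F : ℝ → ℝ} (hF : IsPrimitive f F) {α β : ℝ} (hαβ : α ≤ β) :
    HasWeakDeriv (Ioo α β) F f := by
  refine ⟨hF.continuous.locallyIntegrable.locallyIntegrableOn _, ?_, fun φ hφ _ hs => ?_⟩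
  · exact ((intervalIntegrable_iff_integrableOn_Ioo_of_le hαβ).1 (hF.1 α β)).locallyIntegrableOn
  · rw [← integral_Ioc_eq_integral_Ioo, ← integral_Ioc_eq_integral_Ioo,
      ← intervalIntegral.integral_of_le hαβ, ← intervalIntegral.integral_of_le hαβ,
      hF.integral_mul_eq hφ.isPrimitive_deriv, eq_zero_of_tsupport_subset hs (x := β) (by simp),
      eq_zero_of_tsupport_subset hs (x := α) (by simp)]
    ring

theorem _root_.MeasureTheory.LocallyIntegrableOn.congr_ae {f g : ℝ → ℝ} {s : Set ℝ}
    (hf : LocallyIntegrableOn f s) (h : f =ᵐ[volume.restrict s] g) :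
    LocallyIntegrableOn g s := by
  intro x hx
  obtain ⟨t, ht, hft⟩ := hf x hx
  refine ⟨t ∩ s, Filter.inter_mem ht self_mem_nhdsWithin, ?_⟩
  exact (hft.mono_set inter_subset_left).congr_fun_ae
    (ae_restrict_of_ae_restrict_of_subset inter_subset_right h)

theorem HasWeakDeriv.congr {f f' g g' : ℝ → ℝ} {s : Set ℝ}
    (h : HasWeakDeriv s f f') (hf : f =ᵐ[volume.restrict s] g)
    (hf' : f' =ᵐ[volume.restrict s] g') : HasWeakDeriv s g g' := by
  refine ⟨h.1.congr_ae hf, h.2.congr_ae hf', fun φ h1 h2 h3 => ?_⟩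
  have e1 : ∫ x in s, f x * deriv φ x = ∫ x in s, g x * deriv φ x :=
    integral_congr_ae (hf.mono fun x hx => congrArg (· * deriv φ x) hx)
  have e2 : ∫ x in s, f' x * φ x = ∫ x in s, g' x * φ x :=
    integral_congr_ae (hf'.mono fun x hx => congrArg (· * φ x) hx)
  rw [← e1, ← e2, h.3 φ h1 h2 h3]

theorem _root_.MeasureTheory.LocallyIntegrableOn.integrableOn_mul {k φ : ℝ → ℝ} {s : Set ℝ}
    (hk : LocallyIntegrableOn k s) (h1 : Continuous φ) (h2 : HasCompactSupport φ)
    (h3 : tsupport φ ⊆ s) : IntegrableOn (fun x => k x * φ x) s := by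
  have hK : IntegrableOn k (tsupport φ) := hk.integrableOn_compact_subset h3 h2
  have : IntegrableOn (fun x => k x * φ x) (tsupport φ) :=
    hK.mul_continuousOn h1.continuousOn h2
  refine (this.integrable_of_forall_notMem_eq_zero fun x hx => ?_).integrableOn
  rw [image_eq_zero_of_notMem_tsupport hx, mul_zero]

theorem ae_eq_of_integral_mul_test_eq {f g : ℝ → ℝ} {s : Set ℝ} (hs : IsOpen s)
    (hf : LocallyIntegrableOn f s) (hg : LocallyIntegrableOn g s)
    (h : ∀ φ : ℝ → ℝ, ContDiff ℝ ∞ φ → HasCompactSupport φ → tsupport φ ⊆ s →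
      ∫ x in s, f x * φ x = ∫ x in s, g x * φ x) : f =ᵐ[volume.restrict s] g := by
  have key : ∀ᵐ x, x ∈ s → (f - g) x = 0 := by
    refine hs.ae_eq_zero_of_integral_contDiff_smul_eq_zero (hf.sub hg) fun φ h1 h2 h3 => ?_
    rw [← setIntegral_eq_integral_of_forall_compl_eq_zero (s := s)]
    · have := h φ h1 h2 h3
      rw [← sub_eq_zero, ← integral_sub (hf.integrableOn_mul h1.continuous h2 h3)
        (hg.integrableOn_mul h1.continuous h2 h3)] at this
      rw [← this]
      congr 1
      funext x
      simp [smul_eq_mul]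
      ring
    · intro x hx
      rw [eq_zero_of_tsupport_subset h3 hx, zero_smul]
  rw [Filter.EventuallyEq, ae_restrict_iff' hs.measurableSet]
  filter_upwards [key] with x hx hxs
  exact sub_eq_zero.1 (hx hxs)

theorem HasWeakDeriv.ae_unique {f f' g' : ℝ → ℝ} {s : Set ℝ} (hs : IsOpen s)
    (h : HasWeakDeriv s f f') (h' : HasWeakDeriv s f g') : f' =ᵐ[volume.restrict s] g' :=
  ae_eq_of_integral_mul_test_eq hs h.2 h'.2 fun φ h1 h2 h3 => by
    rw [← neg_inj, ← h.3 φ h1 h2 h3, h'.3 φ h1 h2 h3]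

theorem HasWeakDeriv.weakDeriv_ae_eq {f f' : ℝ → ℝ} {s : Set ℝ} (hs : IsOpen s)
    (h : HasWeakDeriv s f f') : weakDeriv s f =ᵐ[volume.restrict s] f' :=
  HasWeakDeriv.ae_unique hs (Classical.epsilon_spec ⟨f', h⟩) h

/-- A test function with mean zero is the derivative of a test function. -/
theorem exists_test_primitive {α β : ℝ} {θ : ℝ → ℝ} (h1 : ContDiff ℝ ∞ θ)
    (h2 : HasCompactSupport θ) (h3 : tsupport θ ⊆ Ioo α β) (h0 : ∫ x, θ x = 0) :
    ∃ η : ℝ → ℝ, ContDiff ℝ ∞ η ∧ HasCompactSupport η ∧ tsupport η ⊆ Ioo α β ∧ deriv η = θ := by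
  rcases (tsupport θ).eq_empty_or_nonempty with he | hne
  · have : θ = 0 := tsupport_eq_empty_iff.1 he
    exact ⟨0, contDiff_const, HasCompactSupport.zero, by simp [tsupport], by
      rw [this]; exact deriv_const' 0⟩
  obtain ⟨c, hc, hcl⟩ := h2.isCompact.exists_isLeast hne
  obtain ⟨d, hd, hdu⟩ := h2.isCompact.exists_isGreatest hne
  have hder : ∀ x, HasDerivAt (fun x => ∫ t in α..x, θ t) (θ x) x := fun x =>
    h1.continuous.integral_hasStrictDerivAt α x |>.hasDerivAt
  have hderiv : deriv (fun x => ∫ t in α..x, θ t) = θ := funext fun x => (hder x).deriv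
  have hθ : ∀ x, x ∉ Icc c d → θ x = 0 := fun x hx =>
    image_eq_zero_of_notMem_tsupport fun h => hx ⟨hcl h, hdu h⟩
  have hsupp : tsupport (fun x => ∫ t in α..x, θ t) ⊆ Icc c d := by
    refine closure_minimal (fun x hx => ?_) isClosed_Icc
    by_contra hx'
    refine hx ?_
    rw [mem_Icc, not_and_or, not_le, not_le] at hx'
    rcases hx' with hx' | hx'
    · refine intervalIntegral.integral_zero_ae (.of_forall fun t ht => hθ t fun ht' => ?_)
      have := ht.2.trans (max_lt (h3 hc).1 hx').le
      have h4 := max_lt (h3 hc).1 hx'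
      linarith [ht.2, ht'.1]
    · beta_reduce
      rw [intervalIntegral.integral_of_le (by linarith [(h3 hd).1]),
        setIntegral_eq_integral_of_forall_compl_eq_zero, h0]
      intro t ht
      refine hθ t fun ht' => ht ⟨by linarith [ht'.1, (h3 hc).1], by linarith [ht'.2]⟩
  refine ⟨fun x => ∫ t in α..x, θ t, ?_, ?_, ?_, hderiv⟩
  · rw [contDiff_infty_iff_deriv, hderiv]
    exact ⟨fun x => (hder x).differentiableAt, h1⟩
  · exact isCompact_Icc.of_isClosed_subset (isClosed_tsupport _) hsupp
  · exact hsupp.trans (Icc_subset_Ioo (h3 hc).1 (h3 hd).2)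

/-- The lemma of du Bois-Reymond: a function with weak derivative zero is constant. Subtracting a
multiple of a fixed bump function makes any test function a derivative of a test function. -/
theorem HasWeakDeriv.exists_ae_eq_const {f : ℝ → ℝ} {α β : ℝ} (hαβ : α < β)
    (h : HasWeakDeriv (Ioo α β) f 0) : ∃ c : ℝ, f =ᵐ[volume.restrict (Ioo α β)] fun _ => c := by
  set m := (α + β) / 2 with hm
  let ψb : ContDiffBump m := ⟨(β - α) / 8, (β - α) / 4, by linarith, by linarith⟩
  set ψ : ℝ → ℝ := ψb.normed volume with hψ
  have ψ1 : ContDiff ℝ ∞ ψ := ψb.contDiff_normed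
  have ψ2 : HasCompactSupport ψ := ψb.hasCompactSupport_normed
  have ψ3 : tsupport ψ ⊆ Ioo α β := by
    rw [hψ, ψb.tsupport_normed_eq, Real.closedBall_eq_Icc]
    refine Icc_subset_Ioo ?_ ?_ <;> simp only [ψb, hm] <;> linarith
  have ψ4 : ∫ x, ψ x = 1 := ψb.integral_normed
  refine ⟨∫ x in Ioo α β, f x * ψ x, ae_eq_of_integral_mul_test_eq isOpen_Ioo h.1
    (continuous_const.locallyIntegrable.locallyIntegrableOn _) fun φ h1 h2 h3 => ?_⟩
  have hφi : ∫ x in Ioo α β, φ x = ∫ x, φ x :=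
    setIntegral_eq_integral_of_forall_compl_eq_zero fun x hx => eq_zero_of_tsupport_subset h3 hx
  set θ : ℝ → ℝ := fun x => φ x - (∫ y, φ y) * ψ x with hθ
  have hts : tsupport θ ⊆ tsupport φ ∪ tsupport ψ := by
    refine closure_minimal (fun x hx => ?_) ((isClosed_tsupport _).union (isClosed_tsupport _))
    by_contra hx'
    rw [mem_union, not_or] at hx'
    refine hx ?_
    simp only [hθ]
    rw [image_eq_zero_of_notMem_tsupport hx'.1, image_eq_zero_of_notMem_tsupport hx'.2]
    ring
  have hθi : ∫ x, θ x = 0 := by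
    simp only [hθ]
    rw [integral_sub (h1.continuous.integrable_of_hasCompactSupport h2)
      ((ψ1.continuous.integrable_of_hasCompactSupport ψ2).const_mul _), integral_const_mul, ψ4]
    ring
  obtain ⟨η, e1, e2, e3, e4⟩ := exists_test_primitive (α := α) (β := β) (θ := θ)
    (h1.sub (contDiff_const.mul ψ1))
    ((h2.isCompact.union ψ2.isCompact).of_isClosed_subset (isClosed_tsupport _) hts)
    (hts.trans (union_subset h3 ψ3)) hθi
  have h5 := h.3 η e1 e2 e3
  simp only [e4, Pi.zero_apply, zero_mul, integral_zero, neg_zero] at h5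
  have h6 : ∀ x, f x * θ x = f x * φ x - (∫ y, φ y) * (f x * ψ x) := fun x => by
    simp only [hθ]; ring
  simp only [h6] at h5
  rw [integral_sub (h.1.integrableOn_mul h1.continuous h2 h3)
    ((h.1.integrableOn_mul ψ1.continuous ψ2 ψ3).const_mul _), integral_const_mul] at h5
  rw [integral_const_mul, hφi]
  linarith

theorem HasWeakDeriv.exists_isPrimitive {f f' : ℝ → ℝ} {α β : ℝ} (hαβ : α < β)
    (h : HasWeakDeriv (Ioo α β) f f') (hf' : IntegrableOn f' (Ioo α β)) :
    ∃ F, IsPrimitive ((Ioo α β).indicator f') F ∧ f =ᵐ[volume.restrict (Ioo α β)] F := by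
  have hi : Integrable ((Ioo α β).indicator f') := hf'.integrable_indicator measurableSet_Ioo
  have hG := IsPrimitive.of_integral (f := (Ioo α β).indicator f')
    (fun x y => hi.intervalIntegrable) α 0
  set G : ℝ → ℝ := fun x => 0 + ∫ t in α..x, (Ioo α β).indicator f' t with hGdef
  have hw := hG.hasWeakDeriv hαβ.le
  have h0 : HasWeakDeriv (Ioo α β) (fun x => f x - G x) 0 := by
    refine ⟨h.1.sub hw.1, continuous_const.locallyIntegrable.locallyIntegrableOn _,
      fun φ h1 h2 h3 => ?_⟩
    simp only [sub_mul, Pi.zero_apply, zero_mul, integral_zero, neg_zero]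
    have d1 : Continuous (deriv φ) := h1.continuous_deriv (by simp)
    have d3 := (tsupport_deriv_subset (f := φ) (𝕜 := ℝ)).trans h3
    rw [integral_sub (h.1.integrableOn_mul d1 h2.deriv d3) (hw.1.integrableOn_mul d1 h2.deriv d3),
      h.3 φ h1 h2 h3, hw.3 φ h1 h2 h3, sub_eq_zero, neg_inj]
    refine setIntegral_congr_fun measurableSet_Ioo fun x hx => ?_
    simp only [indicator_of_mem hx]
  obtain ⟨c, hc⟩ := h0.exists_ae_eq_const hαβ
  refine ⟨fun x => c + G x, ⟨hG.1, fun x y => by rw [hG.2]; ring⟩, ?_⟩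
  filter_upwards [hc] with x hx
  linarith

/-! ### Piecewise affine functions on a uniform grid -/

/-- `v` is Lipschitz on the line and affine on every cell between neighbouring grid points
`a + j h`, `a + (j + 1) h`, for all integers `j`. -/
structure IsPiecewiseAffine (a h : ℝ) (v : ℝ → ℝ) : Prop where
  lipschitz : ∃ K, LipschitzWith K v
  eq_on_cell : ∀ (j : ℤ) (x : ℝ), x ∈ Icc (node a h j) (node a h (j + 1)) →
    v x = v (node a h j) + (x - node a h j) / h * (v (node a h (j + 1)) - v (node a h j))

theorem node_add_one (a h : ℝ) (j : ℤ) : node a h (j + 1) = node a h j + h := by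
  simp only [node]; push_cast; ring

theorem hat_node {a h : ℝ} (hh : 0 < h) (i j : ℤ) :
    hat a h i (node a h j) = if i = j then 1 else 0 := by
  have e : |node a h j - node a h i| / h = |(j : ℝ) - i| := by
    have : node a h j - node a h i = ((j : ℝ) - i) * h := by simp only [node]; ring
    rw [this, abs_mul, abs_of_pos hh, mul_div_cancel_right₀ _ hh.ne']
  rw [hat, e]
  split_ifs with hij
  · simp [hij]
  · have : (1 : ℤ) ≤ |j - i| := Int.one_le_abs (sub_ne_zero.2 (Ne.symm hij))
    have : (1 : ℝ) ≤ |(j : ℝ) - i| := by exact_mod_cast this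
    exact max_eq_left (by linarith)

theorem hat_eq_zero {a h : ℝ} (hh : 0 < h) {j : ℤ} {x : ℝ} (hx : h ≤ |x - node a h j|) :
    hat a h j x = 0 :=
  max_eq_left (sub_nonpos.2 ((one_le_div hh).2 hx))

theorem isPiecewiseAffine_hat (a : ℝ) {h : ℝ} (hh : 0 < h) (i : ℤ) :
    IsPiecewiseAffine a h (hat a h i) := by
  constructor
  · refine ⟨(1 / h).toNNReal, LipschitzWith.of_dist_le_mul fun x y => ?_⟩
    rw [Real.coe_toNNReal _ (by positivity), Real.dist_eq, Real.dist_eq, hat, hat, max_comm (0 : ℝ),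
      max_comm (0 : ℝ)]
    refine (abs_max_sub_max_le_abs (1 - |x - node a h i| / h) (1 - |y - node a h i| / h)
      (0 : ℝ)).trans ?_
    have e : 1 - |x - node a h i| / h - (1 - |y - node a h i| / h) =
        1 / h * (|y - node a h i| - |x - node a h i|) := by ring
    rw [e, abs_mul, abs_of_pos (by positivity : 0 < 1 / h)]
    have h1 := abs_abs_sub_abs_le (y - node a h i) (x - node a h i)
    rw [sub_sub_sub_cancel_right, abs_sub_comm y x] at h1
    exact mul_le_mul_of_nonneg_left h1 (by positivity)
  · intro j x hx
    rw [node_add_one] at hx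
    have hd : ∀ k : ℤ, node a h k - node a h i = ((k : ℝ) - i) * h := fun k => by
      simp only [node]; ring
    rw [hat_node hh, hat_node hh]
    rcases lt_trichotomy i j with hij | hij | hij
    · rw [if_neg (by omega), if_neg (by omega), hat_eq_zero hh]
      · ring
      · have h1 : (1 : ℝ) ≤ (j : ℝ) - i := by
          have : (1 : ℤ) ≤ j - i := by omega
          exact_mod_cast this
        have := hd j
        refine le_trans ?_ (le_abs_self _)
        nlinarith [hx.1]
    · subst hij
      rw [if_pos rfl, if_neg (by omega), hat, abs_of_nonneg (by linarith [hx.1]), max_eq_right]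
      · ring
      · rw [sub_nonneg, div_le_one hh]; linarith [hx.2]
    · rcases (show i = j + 1 ∨ j + 2 ≤ i by omega) with hi | hi
      · subst hi
        rw [if_neg (by omega), if_pos rfl, hat, node_add_one, abs_of_nonpos (by linarith [hx.2]),
          max_eq_right]
        · field_simp; ring
        · rw [sub_nonneg, div_le_one hh]; linarith [hx.1]
      · rw [if_neg (by omega), if_neg (by omega), hat_eq_zero hh]
        · ring
        · have h1 : (j : ℝ) + 2 - i ≤ 0 := by
            have : j + 2 - i ≤ 0 := by omega
            exact_mod_cast this
          have := hd j
          refine le_trans ?_ (neg_le_abs _)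
          nlinarith [hx.2]

namespace IsPiecewiseAffine

variable {a h : ℝ} {v w : ℝ → ℝ}

theorem zero (a h : ℝ) : IsPiecewiseAffine a h 0 :=
  ⟨⟨0, LipschitzWith.const 0⟩, fun j x _ => by simp⟩

theorem add (hv : IsPiecewiseAffine a h v) (hw : IsPiecewiseAffine a h w) :
    IsPiecewiseAffine a h (v + w) := by
  obtain ⟨K, hK⟩ := hv.lipschitz
  obtain ⟨L, hL⟩ := hw.lipschitz
  refine ⟨⟨K + L, hK.add hL⟩, fun j x hx => ?_⟩
  rw [Pi.add_apply, hv.eq_on_cell j x hx, hw.eq_on_cell j x hx, Pi.add_apply, Pi.add_apply]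
  ring

theorem smul (c : ℝ) (hv : IsPiecewiseAffine a h v) : IsPiecewiseAffine a h (c • v) := by
  obtain ⟨K, hK⟩ := hv.lipschitz
  refine ⟨⟨‖c‖₊ * K, (lipschitzWith_smul c).comp hK⟩, fun j x hx => ?_⟩
  rw [Pi.smul_apply, hv.eq_on_cell j x hx, Pi.smul_apply, Pi.smul_apply]
  simp only [smul_eq_mul]
  ring

theorem continuous (hv : IsPiecewiseAffine a h v) : Continuous v :=
  hv.lipschitz.choose_spec.continuous

theorem isPrimitive (hv : IsPiecewiseAffine a h v) : IsPrimitive (deriv v) v :=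
  .of_lipschitz hv.lipschitz.choose_spec

theorem memLp_sub_deriv (hv : IsPiecewiseAffine a h v) {g : ℝ → ℝ}
    (hg : Continuous g) (x y : ℝ) :
    MemLp (fun t => g t - deriv v t) 2 (volume.restrict (Icc x y)) := by
  obtain ⟨K, hK⟩ := hv.lipschitz
  refine MemLp.sub ?_ ?_
  · obtain ⟨C, hC⟩ := isCompact_Icc.exists_bound_of_continuousOn (hg.continuousOn (s := Icc x y))
    exact MemLp.of_bound hg.aestronglyMeasurable C
      ((ae_restrict_iff' measurableSet_Icc).2 (.of_forall hC))
  · exact MemLp.of_bound (measurable_deriv v).aestronglyMeasurable K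
      (.of_forall fun t => norm_deriv_le_of_lipschitz hK)

theorem deriv_eq (hv : IsPiecewiseAffine a h v) {j : ℤ} {x : ℝ}
    (hx : x ∈ Ioo (node a h j) (node a h (j + 1))) :
    deriv v x = (v (node a h (j + 1)) - v (node a h j)) / h := by
  have he : v =ᶠ[nhds x] fun x => v (node a h j) +
      (x - node a h j) / h * (v (node a h (j + 1)) - v (node a h j)) := by
    filter_upwards [isOpen_Ioo.mem_nhds hx] with y hy
    exact hv.eq_on_cell j y (Ioo_subset_Icc_self hy)
  rw [he.deriv_eq]
  have hd : HasDerivAt (fun x => v (node a h j) +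
      (x - node a h j) / h * (v (node a h (j + 1)) - v (node a h j)))
      (1 / h * (v (node a h (j + 1)) - v (node a h j))) x :=
    ((((hasDerivAt_id x).sub_const _).div_const h).mul_const _).const_add _
  rw [hd.deriv]
  ring

/-- Inside a cell the derivative may be replaced by the slope. -/
theorem integral_cell_congr (hv : IsPiecewiseAffine a h v) (hh : 0 < h) (j : ℤ)
    (Φ : ℝ → ℝ → ℝ) :
    ∫ x in (node a h j)..(node a h (j + 1)), Φ x (deriv v x) =
      ∫ x in (node a h j)..(node a h (j + 1)),
        Φ x ((v (node a h (j + 1)) - v (node a h j)) / h) := by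
  have hle : node a h j ≤ node a h (j + 1) := by rw [node_add_one]; linarith
  rw [intervalIntegral.integral_of_le hle, intervalIntegral.integral_of_le hle,
    integral_Ioc_eq_integral_Ioo, integral_Ioc_eq_integral_Ioo]
  exact setIntegral_congr_fun measurableSet_Ioo fun x hx => by simp only [hv.deriv_eq hx]

end IsPiecewiseAffine

/-- An inequality between integrals over each cell sums up to one over `[a - h, b + h]`. -/
theorem intervalIntegral_mono_of_cells {a b h : ℝ} {n : ℕ} (hb : b = a + n * h) {F G : ℝ → ℝ}
    (hF : IntervalIntegrable F volume (a - h) (b + h))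
    (hG : IntervalIntegrable G volume (a - h) (b + h)) (hh : 0 < h)
    (hle : ∀ j : ℤ, a - h ≤ node a h j → node a h (j + 1) ≤ b + h →
      ∫ x in (node a h j)..(node a h (j + 1)), F x ≤
      ∫ x in (node a h j)..(node a h (j + 1)), G x) :
    ∫ x in (a - h)..(b + h), F x ≤ ∫ x in (a - h)..(b + h), G x := by
  -- the nodes are indexed from `-1`, so that `ξ 0 = a - h`
  set ξ : ℕ → ℝ := fun k => node a h ((k : ℤ) - 1) with hξ
  have e0 : ξ 0 = a - h := by simp only [hξ, node]; push_cast; ring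
  have e1 : ξ (n + 2) = b + h := by simp only [hξ, node]; push_cast; rw [hb]; ring
  have es : ∀ k, ξ (k + 1) = node a h (((k : ℤ) - 1) + 1) := fun k => by
    simp only [hξ]; push_cast; congr 1; ring
  have hlo : ∀ k : ℕ, a - h ≤ ξ k := fun k => by
    simp only [hξ, node]; push_cast; nlinarith [(Nat.cast_nonneg k : (0 : ℝ) ≤ k)]
  have hhi : ∀ k : ℕ, k ≤ n + 2 → ξ k ≤ b + h := fun k hk => by
    have : (k : ℝ) ≤ n + 2 := by exact_mod_cast hk
    simp only [hξ, node]; push_cast; rw [hb]; nlinarith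
  have hsub : ∀ k < n + 2, uIcc (ξ k) (ξ (k + 1)) ⊆ uIcc (a - h) (b + h) := fun k hk => by
    have h1 := hlo k
    have h2 := hhi (k + 1) hk
    have h3 := hhi k hk.le
    have h4 := hlo (k + 1)
    refine uIcc_subset_uIcc (mem_uIcc_of_le h1 h3) (mem_uIcc_of_le h4 h2)
  rw [← e0, ← e1, ← intervalIntegral.sum_integral_adjacent_intervals
    fun k hk => hF.mono_set (hsub k hk), ← intervalIntegral.sum_integral_adjacent_intervals
    fun k hk => hG.mono_set (hsub k hk)]
  refine Finset.sum_le_sum fun k hk => ?_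
  have hk' := Finset.mem_range.1 hk
  have := hle ((k : ℤ) - 1) (hlo k) (by rw [← es]; exact hhi _ hk')
  rwa [← es] at this

/-- The differences of a piecewise affine function control its slopes: two points of the same cell
already give the fraction `1 - |z| / h` of the energy. -/
theorem IsPiecewiseAffine.mul_integral_deriv_sq_le {a b h : ℝ} {v : ℝ → ℝ} {n : ℕ}
    (hv : IsPiecewiseAffine a h v) (hh : 0 < h) (hb : b = a + n * h) {z : ℝ} (hz : |z| ≤ h) :
    z ^ 2 * (1 - |z| / h) * ∫ x in (a - h)..(b + h), deriv v x ^ 2 ≤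
      ∫ x in (a - h)..(b + h), (v (x + z) - v x) ^ 2 := by
  have hc : Continuous fun x => (v (x + z) - v x) ^ 2 :=
    ((hv.continuous.comp (by fun_prop)).sub hv.continuous).pow 2
  have hd : IntervalIntegrable (fun x => deriv v x ^ 2) volume (a - h) (b + h) := by
    have h1 := (hv.memLp_sub_deriv (continuous_const (y := (0 : ℝ))) (a - h)
      (b + h)).integrable_sq
    simp only [zero_sub, neg_sq] at h1
    refine (intervalIntegrable_iff_integrableOn_Icc_of_le ?_).2 h1
    rw [hb]; nlinarith [(Nat.cast_nonneg n : (0 : ℝ) ≤ n)]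
  rw [← intervalIntegral.integral_const_mul]
  refine intervalIntegral_mono_of_cells hb (hd.const_mul _) (hc.intervalIntegrable _ _) hh
    fun j _ _ => ?_
  rw [hv.integral_cell_congr hh j fun _ y => z ^ 2 * (1 - |z| / h) * y ^ 2]
  set s := (v (node a h (j + 1)) - v (node a h j)) / h with hs
  rw [intervalIntegral.integral_const, node_add_one, smul_eq_mul]
  set ξ := node a h j with hξ
  -- `x` and `x + z` lie in the cell if `x` keeps the distance `max 0 (-z)` from its left end and
  -- `max 0 z` from its right end
  have m1 : 0 ≤ max 0 (-z) := le_max_left _ _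
  have m2 : 0 ≤ max 0 z := le_max_left _ _
  have m3 : max 0 (-z) + max 0 z = |z| := by
    rcases le_total 0 z with h0 | h0
    · rw [max_eq_left (by linarith), max_eq_right h0, abs_of_nonneg h0, zero_add]
    · rw [max_eq_right (by linarith), max_eq_left h0, abs_of_nonpos h0, add_zero]
  have hcell : ∀ x ∈ Icc ξ (ξ + h), v x = v ξ + (x - ξ) * s := fun x hx => by
    rw [hv.eq_on_cell j x (by rw [node_add_one]; exact hx), hs]; ring
  have hin : ∫ x in (ξ + max 0 (-z))..(ξ + h - max 0 z), (v (x + z) - v x) ^ 2 =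
      (h - |z|) * (z ^ 2 * s ^ 2) := by
    rw [intervalIntegral.integral_congr (g := fun _ => z ^ 2 * s ^ 2)]
    · rw [intervalIntegral.integral_const, smul_eq_mul, ← m3]; ring
    · intro x hx
      rw [uIcc_of_le (by linarith)] at hx
      have n1 := le_max_right 0 z
      have n2 := le_max_right 0 (-z)
      beta_reduce
      rw [hcell x ⟨by linarith [hx.1], by linarith [hx.2]⟩,
        hcell (x + z) ⟨by linarith [hx.1], by linarith [hx.2]⟩]
      ring
  calc _ = (h - |z|) * (z ^ 2 * s ^ 2) := by field_simp; ring
    _ = _ := hin.symm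
    _ ≤ _ := intervalIntegral.integral_mono_interval (by linarith) (by linarith) (by linarith)
        (.of_forall fun x => sq_nonneg _) (hc.intervalIntegrable _ _)

/-- The first-order interpolation estimate for the derivative. The slope on a cell is a value of
`U' = q` there, by the mean value theorem. -/
theorem IsPiecewiseAffine.integral_interpolation_error_le {a b h : ℝ} {v p q U : ℝ → ℝ} {n : ℕ}
    (hv : IsPiecewiseAffine a h v) (hh : 0 < h) (hb : b = a + n * h) (hp : MemLp p 2 volume)
    (hq : IsPrimitive p q) (hU : ∀ x, HasDerivAt U (q x) x)
    (hvU : ∀ j : ℤ, a - h ≤ node a h j → node a h j ≤ b + h → v (node a h j) = U (node a h j)) :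
    ∫ x in (a - h)..(b + h), (q x - deriv v x) ^ 2 ≤
      h ^ 2 * ∫ x in (a - h)..(b + h), p x ^ 2 := by
  have hab : a - h ≤ b + h := by
    rw [hb]; nlinarith [(Nat.cast_nonneg n : (0 : ℝ) ≤ n)]
  rw [← intervalIntegral.integral_const_mul]
  refine intervalIntegral_mono_of_cells hb ?_ ((hp.intervalIntegrable_sq _ _).const_mul _) hh
    fun j hj1 hj2 => ?_
  · exact (intervalIntegrable_iff_integrableOn_Icc_of_le hab).2
      (hv.memLp_sub_deriv hq.continuous _ _).integrable_sq
  rw [hv.integral_cell_congr hh j fun x y => (q x - y) ^ 2]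
  have hle : node a h j < node a h (j + 1) := by rw [node_add_one]; linarith
  rw [hvU j hj1 (by linarith), hvU (j + 1) (by linarith) hj2]
  obtain ⟨c, hc, hqc⟩ := exists_hasDerivAt_eq_slope U q hle
    (fun x _ => (hU x).continuousAt.continuousWithinAt) fun x _ => hU x
  have hw : node a h (j + 1) - node a h j = h := by rw [node_add_one]; ring
  rw [hw] at hqc
  rw [← hqc]
  have hJ : ∀ x ∈ Icc (node a h j) (node a h (j + 1)), (q x - q c) ^ 2 ≤
      h * ∫ y in (node a h j)..(node a h (j + 1)), p y ^ 2 := by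
    intro x hx
    have h1 := hq.abs_sub_le (x := (node a h j + node a h (j + 1)) / 2)
      (r := (node a h (j + 1) - node a h j) / 2) (s := c) (t := x)
      (abs_le.2 ⟨by linarith [hc.1], by linarith [hc.2]⟩)
      (abs_le.2 ⟨by linarith [hx.1], by linarith [hx.2]⟩)
    have e1 : (node a h j + node a h (j + 1)) / 2 - (node a h (j + 1) - node a h j) / 2 =
      node a h j := by ring
    have e2 : (node a h j + node a h (j + 1)) / 2 + (node a h (j + 1) - node a h j) / 2 =
      node a h (j + 1) := by ring
    rw [e1, e2] at h1
    have h2 := pow_le_pow_left₀ (abs_nonneg _) h1 2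
    rw [sq_abs] at h2
    refine h2.trans ?_
    have h3 := sq_intervalIntegral_le hle.le (hp.restrict _)
    rwa [hw] at h3
  calc _ ≤ ∫ x in (node a h j)..(node a h (j + 1)),
        h * ∫ y in (node a h j)..(node a h (j + 1)), p y ^ 2 :=
        intervalIntegral.integral_mono_on hle.le
          (((hq.continuous.sub continuous_const).pow 2).intervalIntegrable _ _) (by simp) hJ
    _ = _ := by
        rw [intervalIntegral.integral_const, smul_eq_mul, hw,
          intervalIntegral.integral_const_mul]; ring

/-! ### The finite element spaces -/

theorem node_mem_wholeDomain_iff {a b h : ℝ} {n : ℕ} (hh : 0 < h) (hb : b = a + n * h) (j : ℤ) :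
    node a h j ∈ wholeDomain a b h ↔ j ∈ Finset.Icc (-1 : ℤ) (n + 1) := by
  rw [wholeDomain, mem_Icc, Finset.mem_Icc, node, hb]
  constructor
  · rintro ⟨h1, h2⟩
    have h3 : ((-1 : ℤ) : ℝ) ≤ j := by push_cast; nlinarith
    have h4 : (j : ℝ) ≤ ((n + 1 : ℤ) : ℝ) := by push_cast; nlinarith
    exact ⟨by exact_mod_cast h3, by exact_mod_cast h4⟩
  · rintro ⟨h1, h2⟩
    have h3 : ((-1 : ℤ) : ℝ) ≤ j := by exact_mod_cast h1
    have h4 : (j : ℝ) ≤ ((n + 1 : ℤ) : ℝ) := by exact_mod_cast h2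
    push_cast at h3 h4
    constructor <;> nlinarith

theorem node_mem_Ioo_iff {a b h : ℝ} {n : ℕ} (hh : 0 < h) (hb : b = a + n * h) (j : ℤ) :
    node a h j ∈ Ioo a b ↔ 0 < j ∧ j < n := by
  rw [mem_Ioo, node, hb, lt_add_iff_pos_right, add_lt_add_iff_left, mul_pos_iff_of_pos_right hh,
    mul_lt_mul_iff_left₀ hh]
  norm_cast

theorem isPiecewiseAffine_of_mem_spaceVh {a b δ h : ℝ} (hh : 0 < h) {v : ℝ → ℝ}
    (hv : v ∈ spaceVh a b δ h) : IsPiecewiseAffine a h v := by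
  refine Submodule.span_induction ?_ (.zero a h) (fun _ _ _ _ => .add) (fun c _ _ => .smul c) hv
  rintro _ ⟨j, _, rfl⟩
  exact isPiecewiseAffine_hat a hh j

/-- The piecewise linear interpolant of `u` at the nodes `a - h, …, b + h`, where `b = a + n h`. -/
def interpolant (a h : ℝ) (n : ℕ) (u : ℝ → ℝ) : ℝ → ℝ :=
  ∑ j ∈ Finset.Icc (-1 : ℤ) (n + 1), u (node a h j) • hat a h j

theorem interpolant_mem_spaceVh {a b h : ℝ} {n : ℕ} (hh : 0 < h) (hb : b = a + n * h)
    (u : ℝ → ℝ) : interpolant a h n u ∈ spaceVh a b h h :=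
  Submodule.sum_mem _ fun j hj => Submodule.smul_mem _ _
    (Submodule.subset_span ⟨j, (node_mem_wholeDomain_iff hh hb j).2 hj, rfl⟩)

theorem interpolant_node {a h : ℝ} {n : ℕ} (hh : 0 < h) (u : ℝ → ℝ) {j : ℤ}
    (hj : j ∈ Finset.Icc (-1 : ℤ) (n + 1)) :
    interpolant a h n u (node a h j) = u (node a h j) := by
  simp only [interpolant, Finset.sum_apply, Pi.smul_apply, hat_node hh, smul_eq_mul, mul_ite,
    mul_one, mul_zero]
  rw [Finset.sum_ite_eq' _ j, if_pos hj]

theorem interpolant_eq_self {a b h : ℝ} {n : ℕ} (hh : 0 < h) (hb : b = a + n * h) {v : ℝ → ℝ}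
    (hv : v ∈ spaceVh a b h h) : interpolant a h n v = v := by
  refine Submodule.span_induction ?_ ?_ ?_ ?_ hv
  · rintro _ ⟨i, hi, rfl⟩
    simp only [interpolant, hat_node hh, ite_smul, one_smul, zero_smul]
    rw [Finset.sum_ite_eq, if_pos ((node_mem_wholeDomain_iff hh hb i).1 hi)]
  · simp [interpolant]
  · intro x y _ _ hx hy
    nth_rewrite 2 [← hx, ← hy]
    simp only [interpolant, Pi.add_apply, add_smul, Finset.sum_add_distrib]
  · intro c x _ hx
    nth_rewrite 2 [← hx]
    simp only [interpolant, Pi.smul_apply, smul_assoc, Finset.smul_sum]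

theorem interpolant_sub_mem_spaceVh0 {a b h : ℝ} {n : ℕ} (hh : 0 < h) (hb : b = a + n * h)
    {u v : ℝ → ℝ} (hv : v ∈ spaceVh a b h h)
    (huv : ∀ j ∈ Finset.Icc (-1 : ℤ) (n + 1), node a h j ∈ interaction a b h →
      u (node a h j) = v (node a h j)) :
    interpolant a h n u - v ∈ spaceVh0 a b h := by
  nth_rewrite 1 [← interpolant_eq_self hh hb hv]
  rw [interpolant, interpolant, ← Finset.sum_sub_distrib]
  refine Submodule.sum_mem _ fun j hj => ?_
  rw [← sub_smul]
  by_cases hj' : node a h j ∈ Ioo a b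
  · exact Submodule.smul_mem _ _ (Submodule.subset_span ⟨j, hj', rfl⟩)
  · have hw := (node_mem_wholeDomain_iff hh hb j).2 hj
    rw [mem_Ioo, not_and_or, not_lt, not_lt] at hj'
    rw [huv j hj, sub_self, zero_smul]
    · exact Submodule.zero_mem _
    · exact hj'.imp (fun h1 => ⟨hw.1, h1⟩) fun h1 => ⟨h1, hw.2⟩

theorem eq_zero_of_mem_spaceVh0 {a b h : ℝ} {n : ℕ} (hh : 0 < h) (hb : b = a + n * h)
    {v : ℝ → ℝ} (hv : v ∈ spaceVh0 a b h) {x : ℝ} (hx : x ∉ Ioo a b) : v x = 0 := by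
  refine Submodule.span_induction (p := fun v _ => v x = 0) ?_ rfl ?_ ?_ hv
  · rintro _ ⟨j, hj, rfl⟩
    obtain ⟨h1, h2⟩ := (node_mem_Ioo_iff hh hb j).1 hj
    have h3 : (1 : ℝ) ≤ j := by exact_mod_cast h1
    have h4 : (j : ℝ) + 1 ≤ n := by exact_mod_cast h2
    refine hat_eq_zero hh ?_
    rw [mem_Ioo, not_and_or, not_lt, not_lt] at hx
    simp only [node]
    rcases hx with hx | hx
    · refine le_trans ?_ (neg_le_abs _)
      nlinarith
    · refine le_trans ?_ (le_abs_self _)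
      nlinarith
  · intro f g _ _ hf hg
    rw [Pi.add_apply, hf, hg, add_zero]
  · intro c f _ hf
    rw [Pi.smul_apply, hf, smul_zero]

/-! ### The bilinear form of a single shift -/

/-- The contribution `∫ (v(x+z) - v(x)) (e(x+z) - e(x)) dx` of the interaction distance `z`. -/
def diffForm (z : ℝ) (v e : ℝ → ℝ) : ℝ := ∫ x, (v (x + z) - v x) * (e (x + z) - e x)

theorem _root_.Continuous.memLp_two_restrict_Ioc {f : ℝ → ℝ} (hf : Continuous f) (A B : ℝ) :
    MemLp f 2 (volume.restrict (Ioc A B)) := by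
  obtain ⟨C, hC⟩ := isCompact_Icc.exists_bound_of_continuousOn (hf.continuousOn (s := Icc A B))
  exact MemLp.of_bound hf.aestronglyMeasurable C ((ae_restrict_iff' measurableSet_Ioc).2
    (.of_forall fun x hx => hC x (Ioc_subset_Icc_self hx)))

theorem integrable_mul_of_eq_zero {k e : ℝ → ℝ} {a b : ℝ} (hk : Continuous k) (he : Continuous e)
    (he0 : ∀ x ∉ Ioo a b, e x = 0) : Integrable fun x => k x * e x := by
  refine (hk.mul he).integrable_of_hasCompactSupport
    (HasCompactSupport.of_support_subset_isCompact (isCompact_Icc (a := a) (b := b)) ?_)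
  intro x hx
  by_contra hx'
  exact hx (by rw [Pi.mul_apply, he0 x fun h => hx' (Ioo_subset_Icc_self h), mul_zero])

theorem integral_eq_intervalIntegral {F : ℝ → ℝ} {A B : ℝ} (hAB : A ≤ B)
    (hF : ∀ x ∉ Icc A B, F x = 0) : ∫ x, F x = ∫ x in A..B, F x := by
  rw [intervalIntegral.integral_of_le hAB, ← integral_Icc_eq_integral_Ioc,
    setIntegral_eq_integral_of_forall_compl_eq_zero hF]

/-- Increments of length at most `h` of a function that vanishes outside `(a, b)` vanish unless
both end points lie in `[a - h, b + h]`. -/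
theorem sub_eq_zero_or_mem {a b h x y : ℝ} {e : ℝ → ℝ} (he0 : ∀ x ∉ Ioo a b, e x = 0)
    (hxy : |y - x| ≤ h) :
    e y - e x = 0 ∨ (x ∈ Icc (a - h) (b + h) ∧ y ∈ Icc (a - h) (b + h)) := by
  rw [abs_le] at hxy
  by_cases hx : x ∈ Ioo a b
  · exact Or.inr
      ⟨⟨by linarith [hx.1], by linarith [hx.2]⟩, ⟨by linarith [hx.1], by linarith [hx.2]⟩⟩
  · by_cases hy : y ∈ Ioo a b
    · exact Or.inr
        ⟨⟨by linarith [hy.1], by linarith [hy.2]⟩, ⟨by linarith [hy.1], by linarith [hy.2]⟩⟩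
    · exact Or.inl (by rw [he0 x hx, he0 y hy, sub_zero])

/-- Only the values of `v` on the whole domain enter the shift forms with `|z| ≤ h`. -/
theorem diffForm_congr {a b h z : ℝ} {v w e : ℝ → ℝ} (he0 : ∀ x ∉ Ioo a b, e x = 0)
    (hz : |z| ≤ h) (hvw : EqOn v w (Icc (a - h) (b + h))) : diffForm z v e = diffForm z w e := by
  refine integral_congr_ae (.of_forall fun x => ?_)
  beta_reduce
  rcases sub_eq_zero_or_mem (x := x) (y := x + z) he0 (by simpa using hz) with h0 | ⟨h1, h2⟩
  · rw [h0, mul_zero, mul_zero]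
  · rw [hvw h1, hvw h2]

theorem diffForm_eq_intervalIntegral {a b h z : ℝ} {v e : ℝ → ℝ} (hab : a ≤ b) (hh : 0 ≤ h)
    (he0 : ∀ x ∉ Ioo a b, e x = 0) (hz : |z| ≤ h) :
    diffForm z v e = ∫ x in (a - h)..(b + h), (v (x + z) - v x) * (e (x + z) - e x) := by
  refine integral_eq_intervalIntegral (by linarith) fun x hx => ?_
  rcases sub_eq_zero_or_mem (x := x) (y := x + z) he0 (by simpa using hz) with h0 | ⟨h1, h2⟩
  · rw [h0, mul_zero]
  · exact absurd h1 hx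

theorem diffForm_sub {a b h z : ℝ} {v w e : ℝ → ℝ} (hab : a ≤ b) (hh : 0 ≤ h)
    (he0 : ∀ x ∉ Ioo a b, e x = 0) (hz : |z| ≤ h) (hv : Continuous v) (hw : Continuous w)
    (he : Continuous e) : diffForm z (v - w) e = diffForm z v e - diffForm z w e := by
  rw [diffForm_eq_intervalIntegral hab hh he0 hz, diffForm_eq_intervalIntegral hab hh he0 hz,
    diffForm_eq_intervalIntegral hab hh he0 hz, ← intervalIntegral.integral_sub]
  · congr 1
    funext x
    simp only [Pi.sub_apply]
    ring
  · exact Continuous.intervalIntegrable (by fun_prop) _ _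
  · exact Continuous.intervalIntegrable (by fun_prop) _ _

theorem IsPrimitive.integral_sq_sub_le {f F : ℝ → ℝ} (hF : IsPrimitive f F) (hf : MemLp f 2 volume)
    (z : ℝ) {A B : ℝ} (hAB : A ≤ B) :
    ∫ x in A..B, (F (x + z) - F x) ^ 2 ≤ 4 * z ^ 2 * ∫ t, f t ^ 2 := by
  have hFc := hF.continuous
  have h1 := integral_sq_movingIntegral_le hf (abs_nonneg z) hAB
  rw [sq_abs] at h1
  refine le_trans (intervalIntegral.integral_mono_on hAB
    (Continuous.intervalIntegrable (by fun_prop) _ _)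
    (((continuous_movingIntegral (f := fun t => |f t|)
    (fun x y => (hf.intervalIntegrable_of_two x y).abs) |z|).pow 2).intervalIntegrable _ _)
    fun x _ => ?_) h1
  rw [← sq_abs]
  exact pow_le_pow_left₀ (abs_nonneg _)
    (hF.abs_sub_le (x := x) (by simp) (by simp)) 2

/-- Boundedness of a single shift. -/
theorem abs_diffForm_le {a b h z : ℝ} {f W w ε e : ℝ → ℝ} (hab : a ≤ b) (hh : 0 ≤ h)
    (he0 : ∀ x ∉ Ioo a b, e x = 0) (hz : |z| ≤ h) (hW : IsPrimitive f W) (hf : MemLp f 2 volume)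
    (hw : EqOn w W (Icc (a - h) (b + h))) (he : IsPrimitive ε e) (hε : MemLp ε 2 volume) :
    |diffForm z w e| ≤ 4 * z ^ 2 * (√(∫ x, f x ^ 2) * √(∫ x, ε x ^ 2)) := by
  have hAB : a - h ≤ b + h := by linarith
  have hWc := hW.continuous
  have hec := he.continuous
  rw [diffForm_congr he0 hz hw, diffForm_eq_intervalIntegral hab hh he0 hz]
  refine (abs_intervalIntegral_mul_le hAB (Continuous.memLp_two_restrict_Ioc (by fun_prop) _ _)
    (Continuous.memLp_two_restrict_Ioc (by fun_prop) _ _)).trans ?_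
  have h4 : 4 * z ^ 2 = (2 * |z|) ^ 2 := by rw [mul_pow, sq_abs]; norm_num
  have h5 : 0 ≤ 2 * |z| := by positivity
  have hs : ∀ t : ℝ, √((2 * |z|) ^ 2 * t) = 2 * |z| * √t := fun t => by
    rw [Real.sqrt_mul (sq_nonneg _), Real.sqrt_sq h5]
  calc _ ≤ √(4 * z ^ 2 * ∫ x, f x ^ 2) * √(4 * z ^ 2 * ∫ x, ε x ^ 2) :=
        mul_le_mul (Real.sqrt_le_sqrt (hW.integral_sq_sub_le hf z hAB))
          (Real.sqrt_le_sqrt (he.integral_sq_sub_le hε z hAB)) (Real.sqrt_nonneg _)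
          (Real.sqrt_nonneg _)
    _ = _ := by rw [h4, hs, hs]; ring

/-- The second difference of a primitive of `U` is `z² U'(x)` up to the oscillation of `U' = q` on
the ball of radius `|z|`. -/
theorem abs_second_difference_sub_le {p q U V : ℝ → ℝ} (hq : IsPrimitive p q)
    (hU : IsPrimitive q U) (hV : IsPrimitive U V) (x z : ℝ) :
    |V (x + z) - 2 * V x + V (x - z) - z ^ 2 * q x| ≤
      z ^ 2 * ∫ y in (x - |z|)..(x + |z|), |p y| := by
  have hUc := hU.continuous
  have hqc := hq.continuous
  set J := ∫ y in (x - |z|)..(x + |z|), |p y| with hJ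
  have h1 : ∀ t ∈ uIoc x (x + z), ‖U t - U (t - z) - z * q x‖ ≤ J * |z| := by
    intro t ht
    have e1 : U t - U (t - z) - z * q x = ∫ s in (t - z)..t, (q s - q x) := by
      rw [intervalIntegral.integral_sub (hqc.intervalIntegrable _ _) (by simp), hU.2,
        intervalIntegral.integral_const, smul_eq_mul]
      ring
    rw [e1]
    refine (intervalIntegral.norm_integral_le_of_norm_le_const (C := J) fun s hs => ?_).trans_eq ?_
    · refine hq.abs_sub_le (x := x) (by simp) ?_
      rw [mem_uIoc] at ht hs
      rw [abs_le]
      have h2 := le_abs_self z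
      have h3 := neg_le_abs z
      rcases ht with ht | ht <;> rcases hs with hs | hs <;> constructor <;>
        linarith [ht.1, ht.2, hs.1, hs.2]
    · congr 2; ring
  have h2 := intervalIntegral.norm_integral_le_of_norm_le_const h1
  have c2 : Continuous fun t => U (t - z) := by fun_prop
  rw [intervalIntegral.integral_sub (f := fun t => U t - U (t - z))
    ((hUc.sub c2).intervalIntegrable _ _) (by simp),
    intervalIntegral.integral_sub (hUc.intervalIntegrable _ _) (c2.intervalIntegrable _ _),
    intervalIntegral.integral_comp_sub_right, hV.2, hV.2, intervalIntegral.integral_const,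
    smul_eq_mul, Real.norm_eq_abs] at h2
  have e3 : V (x + z) - V x - (V (x + z - z) - V (x - z)) - (x + z - x) * (z * q x) =
      V (x + z) - 2 * V x + V (x - z) - z ^ 2 * q x := by
    rw [add_sub_cancel_right]; ring
  have e4 : J * |z| * |x + z - x| = z ^ 2 * J := by
    rw [add_sub_cancel_left, mul_assoc, abs_mul_abs_self]; ring
  rwa [e3, e4] at h2

/-- Summation by parts turns the shift form into the pairing of `e'` with a second difference. -/
theorem diffForm_eq_integral_second_difference {a b A B z : ℝ} {U V ε e : ℝ → ℝ}
    (hAa : A ≤ a) (hab : a ≤ b) (hbB : b ≤ B) (he0 : ∀ x ∉ Ioo a b, e x = 0) (hU : Continuous U)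
    (hV : ∀ x, HasDerivAt V (U x) x) (he : IsPrimitive ε e) :
    diffForm z U e = ∫ x in A..B, (V (x + z) - 2 * V x + V (x - z)) * ε x := by
  have hec := he.continuous
  have hM : ∀ x, HasDerivAt (fun x => V (x + z) - 2 * V x + V (x - z))
      (U (x + z) - 2 * U x + U (x - z)) x := fun x =>
    (((hV (x + z)).comp_add_const x z).sub ((hV x).const_mul 2)).add
      ((hV (x - z)).comp_sub_const x z)
  have hMp := IsPrimitive.of_hasDerivAt hM (by fun_prop)
  rw [hMp.integral_mul_eq he, he0 A (by simp [hAa]), he0 B (by simp [hbB]),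
    ← integral_eq_intervalIntegral (by linarith)]
  · have i1 : Integrable fun x => (U x - U (x - z)) * e x :=
      integrable_mul_of_eq_zero (by fun_prop) hec he0
    have i2 : Integrable fun x => (U (x + z) - U x) * e x :=
      integrable_mul_of_eq_zero (by fun_prop) hec he0
    have i3 : Integrable fun x => (U (x + z) - U x) * e (x + z) := by
      simpa using i1.comp_add_right z
    have e1 : ∫ x, (U (x + z) - U x) * e (x + z) = ∫ x, (U x - U (x - z)) * e x := by
      simpa using integral_add_right_eq_self (fun x => (U x - U (x - z)) * e x) z
    calc diffForm z U e = ∫ x, ((U (x + z) - U x) * e (x + z) - (U (x + z) - U x) * e x) := by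
          simp only [diffForm, mul_sub]
      _ = (∫ x, (U x - U (x - z)) * e x) - ∫ x, (U (x + z) - U x) * e x := by
          rw [integral_sub i3 i2, e1]
      _ = -∫ x, (U (x + z) - 2 * U x + U (x - z)) * e x := by
          rw [← integral_sub i1 i2, ← integral_neg]
          congr 1
          funext x
          ring
      _ = _ := by ring
  · intro x hx
    rw [he0 x fun h => hx ⟨hAa.trans h.1.le, h.2.le.trans hbB⟩, mul_zero]

/-- Consistency of a single shift: `diffForm z U e` is `z² ∫ U' e'` up to third order in `z`. -/
theorem abs_diffForm_sub_le {a b A B z : ℝ} {p q U ε e : ℝ → ℝ}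
    (hAa : A ≤ a) (hab : a ≤ b) (hbB : b ≤ B) (he0 : ∀ x ∉ Ioo a b, e x = 0)
    (hq : IsPrimitive p q) (hp : MemLp p 2 volume) (hU : ∀ x, HasDerivAt U (q x) x)
    (he : IsPrimitive ε e) (hε : MemLp ε 2 volume) :
    |diffForm z U e - z ^ 2 * ∫ x in A..B, q x * ε x| ≤
      2 * |z| ^ 3 * (√(∫ x, p x ^ 2) * √(∫ x, ε x ^ 2)) := by
  have hAB : A ≤ B := by linarith
  have hUp := IsPrimitive.of_hasDerivAt hU hq.continuous
  have hUc := hUp.continuous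
  have hqc := hq.continuous
  set V : ℝ → ℝ := fun x => ∫ t in (0:ℝ)..x, U t with hVdef
  have hV : ∀ x, HasDerivAt V (U x) x := fun x => (hUc.integral_hasStrictDerivAt 0 x).hasDerivAt
  have hVp := IsPrimitive.of_hasDerivAt hV hUc
  have hVc := hVp.continuous
  rw [diffForm_eq_integral_second_difference hAa hab hbB he0 hUc hV he,
    ← intervalIntegral.integral_const_mul, ← intervalIntegral.integral_sub]
  rotate_left
  · exact (he.1 A B).continuousOn_mul (by fun_prop)
  · exact ((he.1 A B).continuousOn_mul (by fun_prop)).const_mul _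
  set R : ℝ → ℝ := fun x => V (x + z) - 2 * V x + V (x - z) - z ^ 2 * q x with hR
  have hRc : Continuous R := by simp only [hR]; fun_prop
  have e1 : ∫ x in A..B, ((V (x + z) - 2 * V x + V (x - z)) * ε x - z ^ 2 * (q x * ε x)) =
      ∫ x in A..B, R x * ε x := by
    congr 1; funext x; simp only [hR]; ring
  rw [e1]
  refine (abs_intervalIntegral_mul_le hAB (hRc.memLp_two_restrict_Ioc _ _)
    (hε.restrict _)).trans ?_
  have hJc := continuous_movingIntegral (f := fun t => |p t|)
    (fun x y => (hp.intervalIntegrable_of_two x y).abs) |z|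
  have h1 : ∫ x in A..B, R x ^ 2 ≤ (2 * |z| ^ 3) ^ 2 * ∫ x, p x ^ 2 := by
    calc _ ≤ ∫ x in A..B, (z ^ 2) ^ 2 * (∫ y in (x - |z|)..(x + |z|), |p y|) ^ 2 := by
          refine intervalIntegral.integral_mono_on hAB ((hRc.pow 2).intervalIntegrable _ _)
            (((hJc.pow 2).const_mul _).intervalIntegrable _ _) fun x _ => ?_
          rw [← sq_abs, ← mul_pow]
          exact pow_le_pow_left₀ (abs_nonneg _)
            (abs_second_difference_sub_le hq hUp hVp x z) 2
      _ = (z ^ 2) ^ 2 * ∫ x in A..B, (∫ y in (x - |z|)..(x + |z|), |p y|) ^ 2 := by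
          rw [intervalIntegral.integral_const_mul]
      _ ≤ (z ^ 2) ^ 2 * (4 * |z| ^ 2 * ∫ t, p t ^ 2) :=
          mul_le_mul_of_nonneg_left (integral_sq_movingIntegral_le hp (abs_nonneg z) hAB)
            (sq_nonneg _)
      _ = _ := by rw [← sq_abs z]; ring
  have h2 : ∫ x in A..B, ε x ^ 2 ≤ ∫ x, ε x ^ 2 := by
    rw [intervalIntegral.integral_of_le hAB]
    exact setIntegral_le_integral hε.integrable_sq (.of_forall fun t => sq_nonneg _)
  calc _ ≤ √((2 * |z| ^ 3) ^ 2 * ∫ x, p x ^ 2) * √(∫ x, ε x ^ 2) :=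
        mul_le_mul (Real.sqrt_le_sqrt h1) (Real.sqrt_le_sqrt h2) (Real.sqrt_nonneg _)
          (Real.sqrt_nonneg _)
    _ = _ := by
        rw [Real.sqrt_mul (sq_nonneg _), Real.sqrt_sq (by positivity)]; ring

/-! ### The nonlocal form as a superposition of shift forms -/

theorem kernel_add (δ x z : ℝ) : kernel δ x (x + z) = if |z| < δ then 1 / δ ^ 3 else 0 := by
  rw [kernel, add_sub_cancel_left]

theorem integrable_shift_product {v e : ℝ → ℝ} (hv : Continuous v) (he : Continuous e)
    (c α β γ δ : ℝ) :
    Integrable (Function.uncurry fun x z : ℝ => c * ((v (x + z) - v x) * (e (x + z) - e x)))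
      ((volume.restrict (Icc α β)).prod (volume.restrict (Ioo γ δ))) := by
  rw [Measure.prod_restrict]
  have hc : Continuous (Function.uncurry fun x z : ℝ =>
      c * ((v (x + z) - v x) * (e (x + z) - e x))) := by
    simp only [Function.uncurry_def]; fun_prop
  have : IntegrableOn (Function.uncurry fun x z : ℝ => c * ((v (x + z) - v x) * (e (x + z) - e x)))
      (Icc α β ×ˢ Icc γ δ) (volume.prod volume) :=
    hc.continuousOn.integrableOn_compact (isCompact_Icc.prod isCompact_Icc)
  exact this.mono_set (prod_mono_right Ioo_subset_Icc_self)

/-- The truncation of both integrals to the whole domain has no effect, since the increments of `e`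
vanish across its boundary; the rest is Fubini's theorem. -/
theorem formD_eq_integral_diffForm {a b h : ℝ} {v e : ℝ → ℝ} (hab : a ≤ b) (hh : 0 ≤ h)
    (hv : Continuous v) (he : Continuous e) (he0 : ∀ x ∉ Ioo a b, e x = 0) :
    formD a b h v e = ∫ z in Ioo (-h) h, 1 / h ^ 3 * diffForm z v e ∧
      IntegrableOn (fun z => 1 / h ^ 3 * diffForm z v e) (Ioo (-h) h) := by
  have hint := integrable_shift_product hv he (1 / h ^ 3) (a - h) (b + h) (-h) h
  have hinner : ∀ x ∈ Icc (a - h) (b + h), ∫ y in Icc (a - h) (b + h),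
      (e y - e x) * kernel h x y * (v y - v x) =
      ∫ z in Ioo (-h) h, 1 / h ^ 3 * ((v (x + z) - v x) * (e (x + z) - e x)) := by
    intro x _
    rw [setIntegral_eq_integral_of_forall_compl_eq_zero, ← integral_add_left_eq_self _ x,
      ← integral_indicator measurableSet_Ioo]
    · congr 1
      funext z
      rw [kernel_add, indicator_apply]
      by_cases hz : |z| < h
      · rw [if_pos hz, if_pos (show z ∈ Ioo (-h) h from abs_lt.1 hz)]; ring
      · rw [if_neg hz, if_neg (show z ∉ Ioo (-h) h from fun h' => hz (abs_lt.2 h'))]; ring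
    · intro y hy
      by_cases hxy : |y - x| < h
      · rcases sub_eq_zero_or_mem he0 hxy.le with h0 | ⟨_, h2⟩
        · rw [h0, zero_mul, zero_mul]
        · exact absurd h2 hy
      · rw [kernel, if_neg hxy]; ring
  have houter : ∀ z ∈ Ioo (-h) h, ∫ x in Icc (a - h) (b + h),
      1 / h ^ 3 * ((v (x + z) - v x) * (e (x + z) - e x)) = 1 / h ^ 3 * diffForm z v e := by
    intro z hz
    rw [integral_const_mul, diffForm_eq_intervalIntegral hab hh he0 (abs_lt.2 hz).le,
      intervalIntegral.integral_of_le (by linarith), integral_Icc_eq_integral_Ioc]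
  constructor
  · rw [formD, wholeDomain, setIntegral_congr_fun measurableSet_Icc hinner,
      integral_integral_swap hint, setIntegral_congr_fun measurableSet_Ioo houter]
  · have h1 := hint.integral_prod_right
    exact h1.congr ((ae_restrict_iff' measurableSet_Ioo).2 (.of_forall houter))

theorem formD_congr {a b h : ℝ} {u U e : ℝ → ℝ}
    (hu : u =ᵐ[volume.restrict (wholeDomain a b h)] U) : formD a b h u e = formD a b h U e := by
  rw [formD, formD]
  refine integral_congr_ae ?_
  filter_upwards [hu] with x hx
  refine integral_congr_ae ?_
  filter_upwards [hu] with y hy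
  rw [hx, hy]

/-- Consistency of the nonlocal form with the local form `(2/3) ∫ U' e'`. -/
theorem abs_formD_sub_le {a b A B h : ℝ} {p q U ε e : ℝ → ℝ} (hh : 0 < h)
    (hAa : A ≤ a) (hab : a ≤ b) (hbB : b ≤ B) (he0 : ∀ x ∉ Ioo a b, e x = 0)
    (hq : IsPrimitive p q) (hp : MemLp p 2 volume) (hU : ∀ x, HasDerivAt U (q x) x)
    (he : IsPrimitive ε e) (hε : MemLp ε 2 volume) :
    |formD a b h U e - 2 / 3 * ∫ x in A..B, q x * ε x| ≤
      4 * h * (√(∫ x, p x ^ 2) * √(∫ x, ε x ^ 2)) := by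
  have hUc := (IsPrimitive.of_hasDerivAt hU hq.continuous).continuous
  obtain ⟨e1, i1⟩ := formD_eq_integral_diffForm hab hh.le hUc he.continuous he0
  set L := ∫ x in A..B, q x * ε x with hL
  set Y := √(∫ x, p x ^ 2) * √(∫ x, ε x ^ 2) with hY
  have hY0 : 0 ≤ Y := by positivity
  have e2 : ∫ z in Ioo (-h) h, 1 / h ^ 3 * (z ^ 2 * L) = 2 / 3 * L := by
    rw [← integral_Ioc_eq_integral_Ioo, ← intervalIntegral.integral_of_le (by linarith),
      intervalIntegral.integral_const_mul, intervalIntegral.integral_mul_const, integral_pow]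
    field_simp
    ring
  have i2 : IntegrableOn (fun z => 1 / h ^ 3 * (z ^ 2 * L)) (Ioo (-h) h) :=
    (Continuous.integrableOn_Icc (by fun_prop)).mono_set Ioo_subset_Icc_self
  rw [e1, ← e2, ← integral_sub i1 i2, ← Real.norm_eq_abs]
  refine (norm_setIntegral_le_of_norm_le_const (C := 2 * Y) (by simp) fun z hz => ?_).trans_eq ?_
  · rw [← mul_sub, norm_mul, Real.norm_eq_abs, Real.norm_eq_abs, abs_of_pos (by positivity)]
    have h1 := abs_diffForm_sub_le (z := z) hAa hab hbB he0 hq hp hU he hε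
    have h2 : |z| ^ 3 ≤ h ^ 3 := pow_le_pow_left₀ (abs_nonneg z) (abs_lt.2 hz).le 3
    calc _ ≤ 1 / h ^ 3 * (2 * h ^ 3 * Y) := by
          refine mul_le_mul_of_nonneg_left (h1.trans ?_) (by positivity)
          exact mul_le_mul_of_nonneg_right (by linarith) hY0
      _ = 2 * Y := by field_simp
  · rw [Measure.real, Real.volume_Ioo, ENNReal.toReal_ofReal (by linarith)]
    ring

theorem memV0_of_continuous {a b h : ℝ} {e : ℝ → ℝ} (hh : 0 < h) (he : Continuous e)
    (he0 : ∀ x ∉ Ioo a b, e x = 0) : MemV0 a b h e := by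
  refine ⟨⟨?_, ?_⟩, ?_⟩
  · rw [wholeDomain, ← Measure.restrict_congr_set Ioc_ae_eq_Icc]
    exact he.memLp_two_restrict_Ioc _ _
  · rw [Measure.prod_restrict]
    have hc : IntegrableOn (fun p : ℝ × ℝ => (e p.2 - e p.1) ^ 2)
        (wholeDomain a b h ×ˢ wholeDomain a b h) (volume.prod volume) :=
      (Continuous.continuousOn (by fun_prop)).integrableOn_compact
        (isCompact_Icc.prod isCompact_Icc)
    refine Integrable.mul_bdd (c := 1 / h ^ 3) hc ?_ (.of_forall fun p => ?_)
    · refine Measurable.aestronglyMeasurable (Measurable.ite ?_ measurable_const measurable_const)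
      exact measurableSet_lt (by fun_prop) measurable_const
    · rw [kernel]
      split_ifs
      · rw [Real.norm_of_nonneg (by positivity)]
      · rw [norm_zero]; positivity
  · refine (ae_restrict_iff' (measurableSet_Icc.union measurableSet_Icc)).2 (.of_forall ?_)
    rintro x (hx | hx)
    · exact he0 x fun h' => absurd h'.1 (not_lt.2 hx.2)
    · exact he0 x fun h' => absurd h'.2 (not_lt.2 hx.1)

/-! ### The quadrature weights -/

/-- The displacement of the quadrature point with index `k` from the centre of the ball. -/
def quadOffset (δ : ℝ) (N : ℕ) (k : ℤ) : ℝ :=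
  (2 * (k : ℝ) - (Int.sign k : ℝ)) * ((δ / (N : ℝ)) / 2)

theorem quadPoint_eq (δ : ℝ) (N : ℕ) (x : ℝ) (k : ℤ) :
    quadPoint δ N x k = x + quadOffset δ N k := rfl

theorem quadOffset_bounds {δ : ℝ} {N : ℕ} (hδ : 0 < δ) (hN : 0 < N) {k : ℤ} (hk : k ∈ quadIdx N) :
    quadOffset δ N k ≠ 0 ∧ |quadOffset δ N k| ≤ δ * (1 - 1 / (2 * N)) := by
  rw [quadIdx, Finset.mem_erase, Finset.mem_Icc] at hk
  obtain ⟨hk0, hk1, hk2⟩ := hk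
  have hN' : (0 : ℝ) < N := by exact_mod_cast hN
  have hs : 0 < δ / N / 2 := by positivity
  have e : δ * (1 - 1 / (2 * N)) = (2 * N - 1) * (δ / N / 2) := by field_simp
  have h1 : ((1 : ℤ) : ℝ) ≤ |2 * (k : ℝ) - (Int.sign k : ℝ)| ∧
      |2 * (k : ℝ) - (Int.sign k : ℝ)| ≤ ((2 * N - 1 : ℤ) : ℝ) := by
    rcases lt_or_gt_of_ne hk0 with h | h
    · rw [Int.sign_eq_neg_one_of_neg h]
      constructor
      · exact_mod_cast (show (1 : ℤ) ≤ |2 * k - -1| by rw [abs_of_neg (by omega)]; omega)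
      · exact_mod_cast (show |2 * k - -1| ≤ (2 * N - 1 : ℤ) by rw [abs_of_neg (by omega)]; omega)
    · rw [Int.sign_eq_one_of_pos h]
      constructor
      · exact_mod_cast (show (1 : ℤ) ≤ |2 * k - 1| by rw [abs_of_pos (by omega)]; omega)
      · exact_mod_cast (show |2 * k - 1| ≤ (2 * N - 1 : ℤ) by rw [abs_of_pos (by omega)]; omega)
  push_cast at h1
  rw [quadOffset, e, abs_mul, abs_of_pos hs]
  refine ⟨mul_ne_zero (fun h0 => ?_) hs.ne', mul_le_mul_of_nonneg_right h1.2 hs.le⟩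
  rw [h0, abs_zero] at h1
  linarith [h1.1]

theorem abs_quadOffset_lt {δ : ℝ} {N : ℕ} (hδ : 0 < δ) (hN : 0 < N) {k : ℤ} (hk : k ∈ quadIdx N) :
    |quadOffset δ N k| < δ := by
  have hN' : (0 : ℝ) < N := by exact_mod_cast hN
  refine (quadOffset_bounds hδ hN hk).2.trans_lt ?_
  have : 0 < δ * (1 / (2 * N)) := by positivity
  linarith

theorem one_mem_quadIdx {N : ℕ} (hN : 0 < N) : (1 : ℤ) ∈ quadIdx N := by
  rw [quadIdx, Finset.mem_erase, Finset.mem_Icc]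
  omega

theorem integral_kernel_mul_sq {δ : ℝ} (hδ : 0 < δ) (x : ℝ) :
    ∫ y in Icc (x - δ) (x + δ), kernel δ x y * (y - x) ^ 2 = 2 / 3 := by
  rw [integral_Icc_eq_integral_Ioo, setIntegral_congr_fun (g := fun y => 1 / δ ^ 3 * (y - x) ^ 2)
    measurableSet_Ioo, ← integral_Ioc_eq_integral_Ioo,
    ← intervalIntegral.integral_of_le (by linarith), intervalIntegral.integral_const_mul,
    intervalIntegral.integral_comp_sub_right (fun y => y ^ 2), integral_pow]
  · field_simp
    ring
  · intro y hy
    beta_reduce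
    rw [kernel, if_pos (abs_lt.2 ⟨by linarith [hy.1], by linarith [hy.2]⟩)]

theorem quadExact_iff {δ : ℝ} {N : ℕ} (hδ : 0 < δ) (hN : 0 < N) (x : ℝ) (wt : ℤ → ℝ) :
    QuadExact δ N x wt ↔ ∑ k ∈ quadIdx N, quadOffset δ N k ^ 2 / δ ^ 3 * wt k = 2 / 3 := by
  rw [QuadExact, integral_kernel_mul_sq hδ]
  refine Eq.congr (Finset.sum_congr rfl fun k hk => ?_) rfl
  rw [quadPoint_eq, kernel_add, if_pos (abs_quadOffset_lt hδ hN hk), add_sub_cancel_left]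
  ring

/-- The minimum-norm solution of the single exactness equation `∑ A_k ω_k = 2/3`, where
`A_k = γ r_k²`. -/
def gmlsWeight (δ : ℝ) (N : ℕ) (k : ℤ) : ℝ :=
  2 / 3 / (∑ j ∈ quadIdx N, (quadOffset δ N j ^ 2 / δ ^ 3) ^ 2) * (quadOffset δ N k ^ 2 / δ ^ 3)

theorem gmlsWeight_nonneg {δ : ℝ} (hδ : 0 < δ) (N : ℕ) (k : ℤ) : 0 ≤ gmlsWeight δ N k := by
  have : 0 ≤ ∑ j ∈ quadIdx N, (quadOffset δ N j ^ 2 / δ ^ 3) ^ 2 :=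
    Finset.sum_nonneg fun j _ => sq_nonneg _
  unfold gmlsWeight
  positivity

theorem sum_gmlsWeight {δ : ℝ} {N : ℕ} (hδ : 0 < δ) (hN : 0 < N) :
    ∑ k ∈ quadIdx N, quadOffset δ N k ^ 2 / δ ^ 3 * gmlsWeight δ N k = 2 / 3 := by
  have hpos : 0 < ∑ j ∈ quadIdx N, (quadOffset δ N j ^ 2 / δ ^ 3) ^ 2 := by
    refine Finset.sum_pos (fun k hk => ?_) ⟨1, one_mem_quadIdx hN⟩
    have := (quadOffset_bounds hδ hN hk).1
    positivity
  unfold gmlsWeight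
  set S := ∑ j ∈ quadIdx N, (quadOffset δ N j ^ 2 / δ ^ 3) ^ 2 with hS
  have : ∀ k ∈ quadIdx N,
      quadOffset δ N k ^ 2 / δ ^ 3 * (2 / 3 / S * (quadOffset δ N k ^ 2 / δ ^ 3))
      = 2 / 3 / S * (quadOffset δ N k ^ 2 / δ ^ 3) ^ 2 := fun k _ => by ring
  rw [Finset.sum_congr rfl this, ← Finset.mul_sum, ← hS]
  field_simp

/-- GMLS weights are unique: the difference from `gmlsWeight` is orthogonal to `gmlsWeight`, because
the latter is a multiple of the constraint vector, so Pythagoras applies. -/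
theorem IsGMLSWeights.eq_gmlsWeight {δ : ℝ} {N : ℕ} (hδ : 0 < δ) (hN : 0 < N) {x : ℝ} {wt : ℤ → ℝ}
    (hwt : IsGMLSWeights δ N x wt) {k : ℤ} (hk : k ∈ quadIdx N) : wt k = gmlsWeight δ N k := by
  have h1 := (quadExact_iff hδ hN x wt).1 hwt.1
  have h2 := hwt.2 _ ((quadExact_iff hδ hN x _).2 (sum_gmlsWeight hδ hN))
  set m := 2 / 3 / (∑ j ∈ quadIdx N, (quadOffset δ N j ^ 2 / δ ^ 3) ^ 2) with hm
  have h3 : ∑ k ∈ quadIdx N, gmlsWeight δ N k * (wt k - gmlsWeight δ N k) = 0 := by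
    have : ∀ k ∈ quadIdx N, gmlsWeight δ N k * (wt k - gmlsWeight δ N k) =
        m * (quadOffset δ N k ^ 2 / δ ^ 3 * wt k
          - quadOffset δ N k ^ 2 / δ ^ 3 * gmlsWeight δ N k) := fun k _ => by
      have e : gmlsWeight δ N k = m * (quadOffset δ N k ^ 2 / δ ^ 3) := rfl
      nth_rewrite 1 [e]
      ring
    rw [Finset.sum_congr rfl this, ← Finset.mul_sum, Finset.sum_sub_distrib, h1,
      sum_gmlsWeight hδ hN, sub_self, mul_zero]
  have h4 : ∑ k ∈ quadIdx N, (wt k - gmlsWeight δ N k) ^ 2 =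
      ∑ k ∈ quadIdx N, wt k ^ 2 - ∑ k ∈ quadIdx N, gmlsWeight δ N k ^ 2 := by
    rw [← sub_zero (_ - _), ← mul_zero (2 : ℝ), ← h3, Finset.mul_sum, ← Finset.sum_sub_distrib,
      ← Finset.sum_sub_distrib]
    exact Finset.sum_congr rfl fun k _ => by ring
  have h5 : ∑ k ∈ quadIdx N, (wt k - gmlsWeight δ N k) ^ 2 = 0 :=
    le_antisymm (by rw [h4]; linarith) (Finset.sum_nonneg fun k _ => sq_nonneg _)
  have h6 := (Finset.sum_eq_zero_iff_of_nonneg fun k _ => sq_nonneg _).1 h5 k hk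
  exact sub_eq_zero.1 (pow_eq_zero_iff (two_ne_zero) |>.1 h6)

/-! ### The discrete form -/

/-- The factor `γ ω_k` of the shift form of the quadrature displacement with index `k`. -/
def quadCoeff (δ : ℝ) (N : ℕ) (k : ℤ) : ℝ := gmlsWeight δ N k / δ ^ 3

theorem quadCoeff_nonneg {δ : ℝ} (hδ : 0 < δ) (N : ℕ) (k : ℤ) : 0 ≤ quadCoeff δ N k :=
  div_nonneg (gmlsWeight_nonneg hδ N k) (by positivity)

theorem sum_quadCoeff_mul_sq {δ : ℝ} {N : ℕ} (hδ : 0 < δ) (hN : 0 < N) :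
    ∑ k ∈ quadIdx N, quadCoeff δ N k * quadOffset δ N k ^ 2 = 2 / 3 := by
  rw [← sum_gmlsWeight hδ hN]
  exact Finset.sum_congr rfl fun k _ => by rw [quadCoeff]; ring

open Classical in
/-- Quadrature points outside the whole domain contribute nothing when `e` vanishes outside
`(a, b)`. -/
theorem formDh_eq_sum_diffForm {a b h : ℝ} {N : ℕ} {wt : ℝ → ℤ → ℝ} {v e : ℝ → ℝ} (hab : a ≤ b)
    (hh : 0 < h) (hN : 0 < N) (hwt : ∀ x ∈ wholeDomain a b h, IsGMLSWeights h N x (wt x))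
    (hv : Continuous v) (he : Continuous e) (he0 : ∀ x ∉ Ioo a b, e x = 0) :
    formDh a b h N wt v e = ∑ k ∈ quadIdx N, quadCoeff h N k * diffForm (quadOffset h N k) v e := by
  have h1 : ∀ x ∈ wholeDomain a b h,
      (∑ k ∈ (quadIdx N).filter (fun k => quadPoint h N x k ∈ wholeDomain a b h),
        (e (quadPoint h N x k) - e x) * kernel h x (quadPoint h N x k)
          * (v (quadPoint h N x k) - v x) * wt x k) =
      ∑ k ∈ quadIdx N, quadCoeff h N k *
        ((v (x + quadOffset h N k) - v x) * (e (x + quadOffset h N k) - e x)) := by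
    intro x hx
    rw [Finset.sum_filter]
    refine Finset.sum_congr rfl fun k hk => ?_
    rw [(hwt x hx).eq_gmlsWeight hh hN hk, quadPoint_eq, kernel_add,
      if_pos (abs_quadOffset_lt hh hN hk), quadCoeff]
    split_ifs with hm
    · ring
    · rcases sub_eq_zero_or_mem (x := x) (y := x + quadOffset h N k) he0
        (by simpa using (abs_quadOffset_lt hh hN hk).le) with h0 | ⟨_, h2⟩
      · rw [h0]; ring
      · exact absurd h2 hm
  have hm : MeasurableSet (wholeDomain a b h) := measurableSet_Icc
  rw [formDh, setIntegral_congr_fun hm h1, integral_finsetSum]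
  · refine Finset.sum_congr rfl fun k hk => ?_
    rw [integral_const_mul, diffForm_eq_intervalIntegral hab hh.le he0
      (abs_quadOffset_lt hh hN hk).le, intervalIntegral.integral_of_le (by linarith), wholeDomain,
      integral_Icc_eq_integral_Ioc]
  · intro k _
    exact Continuous.integrableOn_Icc (by fun_prop)

theorem abs_sum_quadCoeff_mul_le {δ : ℝ} {N : ℕ} (hδ : 0 < δ) (hN : 0 < N) {t : ℤ → ℝ} {M : ℝ}
    (ht : ∀ k ∈ quadIdx N, |t k| ≤ quadOffset δ N k ^ 2 * M) :
    |∑ k ∈ quadIdx N, quadCoeff δ N k * t k| ≤ 2 / 3 * M := by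
  rw [← sum_quadCoeff_mul_sq hδ hN, Finset.sum_mul]
  refine (Finset.abs_sum_le_sum_abs _ _).trans (Finset.sum_le_sum fun k hk => ?_)
  rw [abs_mul, abs_of_nonneg (quadCoeff_nonneg hδ N k), mul_assoc]
  exact mul_le_mul_of_nonneg_left (ht k hk) (quadCoeff_nonneg hδ N k)

/-- Coercivity of the discrete form on piecewise affine functions. The displacements stay below
`(1 - 1 / (2N)) h`, which leaves room for pairs of points in a common cell. -/
theorem IsPiecewiseAffine.integral_deriv_sq_le_formDh {a b h : ℝ} {N n : ℕ} {wt : ℝ → ℤ → ℝ}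
    {e : ℝ → ℝ} (hab : a ≤ b) (hh : 0 < h) (hb : b = a + n * h) (hN : 0 < N)
    (hwt : ∀ x ∈ wholeDomain a b h, IsGMLSWeights h N x (wt x))
    (he : IsPiecewiseAffine a h e) (he0 : ∀ x ∉ Ioo a b, e x = 0) :
    1 / (3 * N) * ∫ x in (a - h)..(b + h), deriv e x ^ 2 ≤ formDh a b h N wt e e := by
  have hN' : (0 : ℝ) < N := by exact_mod_cast hN
  set X := ∫ x in (a - h)..(b + h), deriv e x ^ 2 with hX
  have hX0 : 0 ≤ X := intervalIntegral.integral_nonneg (by linarith) fun x _ => sq_nonneg _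
  rw [formDh_eq_sum_diffForm hab hh hN hwt he.continuous he.continuous he0]
  have e1 : 1 / (3 * N) * X =
      ∑ k ∈ quadIdx N, quadCoeff h N k * (quadOffset h N k ^ 2 * (1 / (2 * N)) * X) := by
    simp only [← mul_assoc]
    rw [← Finset.sum_mul, ← Finset.sum_mul, sum_quadCoeff_mul_sq hh hN]
    field_simp
  rw [e1]
  refine Finset.sum_le_sum fun k hk => mul_le_mul_of_nonneg_left ?_ (quadCoeff_nonneg hh N k)
  have hlt := (abs_quadOffset_lt hh hN hk).le
  rw [diffForm_eq_intervalIntegral hab hh.le he0 hlt]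
  simp only [← pow_two]
  refine le_trans (mul_le_mul_of_nonneg_right (mul_le_mul_of_nonneg_left ?_ (sq_nonneg _)) hX0)
    (he.mul_integral_deriv_sq_le hh hb hlt)
  have h2 := (quadOffset_bounds hh hN hk).2
  rw [le_sub_comm, div_le_iff₀ hh]
  linarith

theorem deriv_eq_zero_of_eq_zero {a b : ℝ} {e : ℝ → ℝ}
    (he0 : ∀ x ∉ Ioo a b, e x = 0) {x : ℝ} (hx : x ∉ Icc a b) : deriv e x = 0 := by
  have : e =ᶠ[nhds x] fun _ => 0 := by
    filter_upwards [isClosed_Icc.isOpen_compl.mem_nhds hx] with y hy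
    exact he0 y fun h => hy (Ioo_subset_Icc_self h)
  rw [this.deriv_eq, deriv_const]

theorem IsPiecewiseAffine.memLp_deriv {a b h : ℝ} {e : ℝ → ℝ} (he : IsPiecewiseAffine a h e)
    (he0 : ∀ x ∉ Ioo a b, e x = 0) : MemLp (deriv e) 2 volume := by
  have h1 := he.memLp_sub_deriv (continuous_const (y := (0 : ℝ))) a b
  simp only [zero_sub] at h1
  have h2 := (memLp_indicator_iff_restrict measurableSet_Icc).2 h1.neg
  convert h2 using 1
  funext x
  by_cases hx : x ∈ Icc a b
  · simp [indicator_of_mem hx]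
  · rw [indicator_of_notMem hx, deriv_eq_zero_of_eq_zero he0 hx]

/-- The energy estimate: the finite element solution is within `O(h)` of the interpolant. -/
theorem energy_estimate {a b h : ℝ} {N n : ℕ} {wt : ℝ → ℤ → ℝ} {p q U v uh : ℝ → ℝ}
    (hab : a ≤ b) (hh : 0 < h) (hb : b = a + n * h) (hN : 0 < N)
    (hwt : ∀ x ∈ wholeDomain a b h, IsGMLSWeights h N x (wt x))
    (hq : IsPrimitive p q) (hp : MemLp p 2 volume) (hU : ∀ x, HasDerivAt U (q x) x)
    (hv : IsPiecewiseAffine a h v) (huh : IsPiecewiseAffine a h uh)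
    (hvU : ∀ j : ℤ, a - h ≤ node a h j → node a h j ≤ b + h → v (node a h j) = U (node a h j))
    (he : IsPiecewiseAffine a h (v - uh)) (he0 : ∀ x ∉ Ioo a b, (v - uh) x = 0)
    (heq : formDh a b h N wt uh (v - uh) = formD a b h U (v - uh)) :
    √(∫ x, deriv (v - uh) x ^ 2) ≤ 24 * N * h * √(∫ x, p x ^ 2) := by
  set e := v - uh with hedef
  have hN' : (0 : ℝ) < N := by exact_mod_cast hN
  have hAB : a - h ≤ b + h := by linarith
  have hUp := IsPrimitive.of_hasDerivAt hU hq.continuous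
  have hec := he.continuous
  have hep := he.isPrimitive
  have hε := he.memLp_deriv he0
  set X := √(∫ x, deriv e x ^ 2) with hX
  set Y := √(∫ x, p x ^ 2) with hY
  have hX0 : 0 ≤ X := Real.sqrt_nonneg _
  have hY0 : 0 ≤ Y := Real.sqrt_nonneg _
  have hX2 : ∫ x in (a - h)..(b + h), deriv e x ^ 2 = X ^ 2 := by
    rw [hX, Real.sq_sqrt (integral_nonneg fun x => sq_nonneg _),
      ← integral_eq_intervalIntegral hAB]
    intro x hx
    rw [deriv_eq_zero_of_eq_zero he0 fun hx' =>
      hx ⟨by linarith [hx'.1], by linarith [hx'.2]⟩]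
    norm_num
  -- the interpolation error, cut off outside the whole domain
  set f : ℝ → ℝ := (Icc (a - h) (b + h)).indicator fun x => q x - deriv v x with hf
  have hfL : MemLp f 2 volume := (memLp_indicator_iff_restrict measurableSet_Icc).2
    (hv.memLp_sub_deriv hq.continuous _ _)
  have hW := IsPrimitive.of_integral (fun x y => hfL.intervalIntegrable_of_two x y) (a - h) 0
  set W : ℝ → ℝ := fun x => 0 + ∫ t in (a - h)..x, f t with hWdef
  have hd := hUp.sub hv.isPrimitive
  have hvα : v (a - h) = U (a - h) := by
    have e1 : node a h (-1) = a - h := by simp only [node]; push_cast; ring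
    rw [← e1]
    exact hvU (-1) e1.ge (e1.le.trans hAB)
  have hwW : EqOn (U - v) W (Icc (a - h) (b + h)) := by
    intro x hx
    have e1 : ∫ t in (a - h)..x, f t = ∫ t in (a - h)..x, (q t - deriv v t) := by
      refine intervalIntegral.integral_congr fun t ht => ?_
      rw [uIcc_of_le hx.1] at ht
      exact indicator_of_mem (show t ∈ Icc (a - h) (b + h) from ⟨ht.1, ht.2.trans hx.2⟩) _
    simp only [hWdef, Pi.sub_apply]
    rw [e1, hd.2, hvα]
    ring
  have hfY : √(∫ x, f x ^ 2) ≤ h * Y := by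
    have e1 : ∫ x, f x ^ 2 = ∫ x in (a - h)..(b + h), (q x - deriv v x) ^ 2 := by
      rw [integral_eq_intervalIntegral hAB]
      · refine intervalIntegral.integral_congr fun t ht => ?_
        rw [uIcc_of_le hAB] at ht
        simp only [hf, indicator_of_mem ht]
      · intro x hx
        simp only [hf, indicator_of_notMem hx]
        norm_num
    have e2 : ∫ x in (a - h)..(b + h), p x ^ 2 ≤ ∫ x, p x ^ 2 := by
      rw [intervalIntegral.integral_of_le hAB]
      exact setIntegral_le_integral hp.integrable_sq (.of_forall fun t => sq_nonneg _)
    have e3 := hv.integral_interpolation_error_le hh hb hp hq hU hvU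
    rw [← e1] at e3
    calc √(∫ x, f x ^ 2) ≤ √(h ^ 2 * ∫ x, p x ^ 2) :=
          Real.sqrt_le_sqrt (e3.trans (mul_le_mul_of_nonneg_left e2 (sq_nonneg _)))
      _ = h * Y := by rw [Real.sqrt_mul (sq_nonneg _), Real.sqrt_sq hh.le]
  have c1 := abs_formD_sub_le (A := a - h) (B := b + h) hh (by linarith) hab (by linarith) he0 hq hp
    hU hep hε
  have hsum : ∀ {w : ℝ → ℝ}, Continuous w → formDh a b h N wt w e =
      ∑ k ∈ quadIdx N, quadCoeff h N k * diffForm (quadOffset h N k) w e := fun hw =>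
    formDh_eq_sum_diffForm hab hh hN hwt hw hec he0
  set L := ∫ x in (a - h)..(b + h), q x * deriv e x with hL
  have c2 : |formDh a b h N wt U e - 2 / 3 * L| ≤ 2 / 3 * (2 * h * (Y * X)) := by
    -- written as `∑ c_k r_k²`, the factor `2/3` is compared with `Dʰ` term by term
    rw [hsum hUp.continuous, ← sum_quadCoeff_mul_sq hh hN, Finset.sum_mul,
      ← Finset.sum_sub_distrib]
    simp only [mul_assoc (quadCoeff h N _), ← mul_sub]
    rw [sum_quadCoeff_mul_sq hh hN]
    refine abs_sum_quadCoeff_mul_le hh hN fun k hk => ?_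
    refine (abs_diffForm_sub_le (A := a - h) (B := b + h) (by linarith) hab (by linarith) he0 hq hp
      hU hep hε).trans ?_
    have h1 : |quadOffset h N k| ^ 3 ≤ quadOffset h N k ^ 2 * h := by
      rw [pow_succ, sq_abs]
      exact mul_le_mul_of_nonneg_left (abs_quadOffset_lt hh hN hk).le (sq_nonneg _)
    calc _ ≤ 2 * (quadOffset h N k ^ 2 * h) * (Y * X) :=
          mul_le_mul_of_nonneg_right (by linarith) (by positivity)
      _ = _ := by ring
  have c3 : |formDh a b h N wt (U - v) e| ≤ 2 / 3 * (4 * h * (Y * X)) := by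
    rw [hsum (hUp.continuous.sub hv.continuous)]
    refine abs_sum_quadCoeff_mul_le hh hN fun k hk => ?_
    refine (abs_diffForm_le hab hh.le he0 (abs_quadOffset_lt hh hN hk).le hW hfL hwW hep hε).trans
      ?_
    calc _ ≤ 4 * quadOffset h N k ^ 2 * (h * Y * X) :=
          mul_le_mul_of_nonneg_left (mul_le_mul_of_nonneg_right hfY hX0) (by positivity)
      _ = _ := by ring
  have hlin : ∀ {w w' : ℝ → ℝ}, Continuous w → Continuous w' →
      formDh a b h N wt (w - w') e = formDh a b h N wt w e - formDh a b h N wt w' e := by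
    intro w w' hw hw'
    rw [hsum (hw.sub hw'), hsum hw, hsum hw', ← Finset.sum_sub_distrib]
    refine Finset.sum_congr rfl fun k hk => ?_
    rw [diffForm_sub hab hh.le he0 (abs_quadOffset_lt hh hN hk).le hw hw' hec, mul_sub]
  have hcoer := he.integral_deriv_sq_le_formDh hab hh hb hN hwt he0
  rw [hX2] at hcoer
  have l1 := hlin hUp.continuous hv.continuous
  have l2 := hlin hv.continuous huh.continuous
  rw [← hedef, heq] at l2
  -- the three errors add up to `4 + 4/3 + 8/3 = 8`
  have hfin : 1 / (3 * N) * X ^ 2 ≤ 8 * h * (Y * X) := by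
    have a1 := (abs_le.1 c1).1
    have a2 := (abs_le.1 c2).2
    have a3 := (abs_le.1 c3).1
    rw [l2] at hcoer
    linarith
  rcases hX0.eq_or_lt with h0 | h0
  · rw [← h0]; positivity
  · have h1 : X ^ 2 ≤ 24 * N * h * Y * X := by
      have := mul_le_mul_of_nonneg_left hfin (show (0 : ℝ) ≤ 3 * N by positivity)
      rw [← mul_assoc, mul_one_div_cancel (by positivity), one_mul] at this
      linarith
    rw [pow_two] at h1
    exact le_of_mul_le_mul_right h1 h0

/-! ### From the energy estimate to the Sobolev norms -/

/-- A Poincaré inequality for functions that vanish at the left end. -/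
theorem IsPrimitive.integral_sq_le {f F : ℝ → ℝ} (hF : IsPrimitive f F) {α β : ℝ} (hαβ : α ≤ β)
    (h0 : F α = 0) (hf : MemLp f 2 (volume.restrict (Ioc α β))) :
    ∫ x in α..β, F x ^ 2 ≤ (β - α) ^ 2 * ∫ x in α..β, f x ^ 2 := by
  have hpt : ∀ x ∈ Icc α β, F x ^ 2 ≤ (β - α) * ∫ x in α..β, f x ^ 2 := by
    intro x hx
    have h1 := hF.abs_sub_le (x := (α + β) / 2) (r := (β - α) / 2) (s := α) (t := x)
      (abs_le.2 ⟨by linarith, by linarith⟩) (abs_le.2 ⟨by linarith [hx.1], by linarith [hx.2]⟩)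
    have e1 : (α + β) / 2 - (β - α) / 2 = α := by ring
    have e2 : (α + β) / 2 + (β - α) / 2 = β := by ring
    rw [e1, e2, h0, sub_zero] at h1
    have h2 := pow_le_pow_left₀ (abs_nonneg _) h1 2
    rw [sq_abs] at h2
    exact h2.trans (sq_intervalIntegral_le hαβ hf)
  calc _ ≤ ∫ x in α..β, (β - α) * ∫ x in α..β, f x ^ 2 :=
        intervalIntegral.integral_mono_on hαβ ((hF.continuous.pow 2).intervalIntegrable _ _)
          (by simp) hpt
    _ = _ := by rw [intervalIntegral.integral_const, smul_eq_mul]; ring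

/-- A function in `H²` of an interval is almost everywhere equal to a `C¹` function on the line
whose derivative is a primitive of the square-integrable zero extension of `u''`. -/
theorem MemH2.exists_representative {α β : ℝ} (hαβ : α < β) {u : ℝ → ℝ} (hu : MemH2 (Ioo α β) u) :
    ∃ p q U : ℝ → ℝ, MemLp p 2 volume ∧ IsPrimitive p q ∧ (∀ x, HasDerivAt U (q x) x) ∧
      u =ᵐ[volume.restrict (Ioo α β)] U ∧
      √(∫ x, p x ^ 2) ≤ normH2 (Ioo α β) u := by
  obtain ⟨_, u', u'', h1, h2, h3, h4⟩ := hu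
  obtain ⟨q, hq, hqe⟩ := h3.exists_isPrimitive hαβ (h4.integrable (by norm_num))
  have hwq : HasWeakDeriv (Ioo α β) u q := h1.congr (.refl _ _) hqe
  have hqi : IntegrableOn q (Ioo α β) :=
    (hq.continuous.integrableOn_Icc).mono_set Ioo_subset_Icc_self
  obtain ⟨F, hF, hFe⟩ := hwq.exists_isPrimitive hαβ hqi
  refine ⟨(Ioo α β).indicator u'', q, fun x => F α + ∫ t in α..x, q t,
    (memLp_indicator_iff_restrict measurableSet_Ioo).2 h4, hq,
    fun x => (hq.continuous.integral_hasStrictDerivAt α x).hasDerivAt.const_add _, ?_, ?_⟩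
  · refine hFe.trans ((ae_restrict_iff' measurableSet_Ioo).2 (.of_forall fun x hx => ?_))
    refine (congrFun (hF.eq_add α) x).trans ((add_right_inj _).2 ?_)
    rw [intervalIntegral.integral_of_le hx.1.le, intervalIntegral.integral_of_le hx.1.le]
    exact setIntegral_congr_fun measurableSet_Ioc fun t ht =>
      indicator_of_mem (show t ∈ Ioo α β from ⟨ht.1, ht.2.trans_lt hx.2⟩) _
  · have e1 : weakDeriv (Ioo α β) u =ᵐ[volume.restrict (Ioo α β)] u' :=
      h1.weakDeriv_ae_eq isOpen_Ioo
    have h5 : HasWeakDeriv (Ioo α β) (weakDeriv (Ioo α β) u) u'' := h3.congr e1.symm (.refl _ _)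
    have e2 := h5.weakDeriv_ae_eq isOpen_Ioo
    have e3 : ∫ x, (Ioo α β).indicator u'' x ^ 2 =
        ∫ x in Ioo α β, weakDeriv (Ioo α β) (weakDeriv (Ioo α β) u) x ^ 2 := by
      rw [integral_congr_ae (e2.mono fun x hx => congrArg (· ^ 2) hx),
        ← integral_indicator measurableSet_Ioo]
      congr 1
      funext x
      by_cases hx : x ∈ Ioo α β
      · simp only [indicator_of_mem hx]
      · simp only [indicator_of_notMem hx]; norm_num
    rw [e3, normH2]
    refine Real.sqrt_le_sqrt (le_add_of_nonneg_left (add_nonneg ?_ ?_)) <;>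
      exact integral_nonneg fun x => sq_nonneg _

/-- The `H¹` norm of a function with an absolutely continuous representative can be computed from
any primitive representation, because weak derivatives are unique almost everywhere. -/
theorem memH1_and_normH1_eq {α β : ℝ} (hαβ : α ≤ β) {w d d' : ℝ → ℝ} (hd : IsPrimitive d' d)
    (hw : w =ᵐ[volume.restrict (Ioo α β)] d) (hd' : MemLp d' 2 (volume.restrict (Icc α β))) :
    MemH1 (Ioo α β) w ∧
      normH1 (Ioo α β) w = √((∫ x in α..β, d x ^ 2) + ∫ x in α..β, d' x ^ 2) := by
  have hwd : HasWeakDeriv (Ioo α β) w d' := (hd.hasWeakDeriv hαβ).congr hw.symm (.refl _ _)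
  refine ⟨⟨?_, d', hwd, hd'.mono_measure (Measure.restrict_mono_set _ Ioo_subset_Icc_self)⟩, ?_⟩
  · exact ((hd.continuous.memLp_two_restrict_Ioc α β).mono_measure
      (Measure.restrict_mono_set _ Ioo_subset_Ioc_self)).ae_eq hw.symm
  · have e2 := hwd.weakDeriv_ae_eq isOpen_Ioo
    rw [normH1, integral_congr_ae (hw.mono fun x hx => congrArg (· ^ 2) hx),
      integral_congr_ae (e2.mono fun x hx => congrArg (· ^ 2) hx),
      intervalIntegral.integral_of_le hαβ, intervalIntegral.integral_of_le hαβ,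
      integral_Ioc_eq_integral_Ioo, integral_Ioc_eq_integral_Ioo]

theorem integral_add_sq_le {α β : ℝ} (hαβ : α ≤ β) {f g : ℝ → ℝ}
    (hf : MemLp f 2 (volume.restrict (Ioc α β))) (hg : MemLp g 2 (volume.restrict (Ioc α β))) :
    ∫ x in α..β, (f x + g x) ^ 2 ≤ 2 * (∫ x in α..β, f x ^ 2) + 2 * ∫ x in α..β, g x ^ 2 := by
  simp only [intervalIntegral.integral_of_le hαβ]
  rw [← integral_const_mul, ← integral_const_mul,
    ← integral_add (hf.integrable_sq.const_mul 2) (hg.integrable_sq.const_mul 2)]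
  exact integral_mono (hf.add hg).integrable_sq
    ((hf.integrable_sq.const_mul 2).add (hg.integrable_sq.const_mul 2))
    fun x => by beta_reduce; nlinarith [sq_nonneg (f x - g x)]

/-- The error estimate with an explicit constant. -/
theorem error_estimate {a b h : ℝ} {N n : ℕ} {wt : ℝ → ℤ → ℝ} {f g u uh : ℝ → ℝ}
    (hab : a < b) (hh : 0 < h) (hhab : h ≤ b - a) (hb : b = a + n * h) (hN : 0 < N)
    (hwt : ∀ x ∈ wholeDomain a b h, IsGMLSWeights h N x (wt x))
    (hg : ContinuousOn g (interaction a b h)) (hu : IsNonlocalSolution a b h f g u)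
    (hu2 : MemH2 (Ioo (a - h) (b + h)) u) (huh : IsDiscreteSolution a b h h N wt f g uh) :
    MemH1 (Ioo (a - h) (b + h)) (fun x => u x - uh x) ∧
      normH1 (Ioo (a - h) (b + h)) (fun x => u x - uh x) ≤
        √((1 + 9 * (b - a) ^ 2) * (2 + 1152 * N ^ 2)) * normH2 (Ioo (a - h) (b + h)) u * h := by
  have hAB : a - h < b + h := by linarith
  obtain ⟨p, q, U, hp, hq, hU, huU, hpY⟩ := hu2.exists_representative hAB
  have hUp := IsPrimitive.of_hasDerivAt hU hq.continuous
  have huU' : u =ᵐ[volume.restrict (wholeDomain a b h)] U := by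
    rwa [wholeDomain, ← Measure.restrict_congr_set Ioo_ae_eq_Icc]
  -- the boundary values of the continuous representative are those of `g`
  have hUg : EqOn U g (interaction a b h) := by
    have hsub : interaction a b h ⊆ wholeDomain a b h := union_subset
      (Icc_subset_Icc_right (by linarith)) (Icc_subset_Icc_left (by linarith))
    have hae : U =ᵐ[volume.restrict (interaction a b h)] g :=
      Filter.EventuallyEq.trans (ae_restrict_of_ae_restrict_of_subset hsub huU'.symm)
        hu.constraint
    rintro x (hx | hx)
    · exact Measure.eqOn_Icc_of_ae_eq volume (by linarith)
        (ae_restrict_of_ae_restrict_of_subset subset_union_left hae)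
        hUp.continuous.continuousOn (hg.mono subset_union_left) hx
    · exact Measure.eqOn_Icc_of_ae_eq volume (by linarith)
        (ae_restrict_of_ae_restrict_of_subset subset_union_right hae)
        hUp.continuous.continuousOn (hg.mono subset_union_right) hx
  set v := interpolant a h n U with hv
  have hvm := interpolant_mem_spaceVh hh hb U
  have hvp := isPiecewiseAffine_of_mem_spaceVh hh hvm
  have huhp := isPiecewiseAffine_of_mem_spaceVh hh huh.mem
  have hvU : ∀ j : ℤ, a - h ≤ node a h j → node a h j ≤ b + h → v (node a h j) = U (node a h j) :=
    fun j h1 h2 => interpolant_node hh U ((node_mem_wholeDomain_iff hh hb j).1 ⟨h1, h2⟩)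
  have hem : v - uh ∈ spaceVh0 a b h := interpolant_sub_mem_spaceVh0 hh hb huh.mem
    fun j _ hj => by rw [huh.constraint j hj, hUg hj]
  have hep := isPiecewiseAffine_of_mem_spaceVh hh (Submodule.sub_mem _ hvm huh.mem)
  have he0 : ∀ x ∉ Ioo a b, (v - uh) x = 0 := fun x hx => eq_zero_of_mem_spaceVh0 hh hb hem hx
  have heq : formDh a b h N wt uh (v - uh) = formD a b h U (v - uh) := by
    rw [huh.discrete_eq _ hem, ← formD_congr huU',
      hu.weak_eq _ (memV0_of_continuous hh hep.continuous he0)]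
  have hX := energy_estimate hab.le hh hb hN hwt hq hp hU hvp huhp hvU hep he0 heq
  -- the error is a primitive of `(q - v') + e'`
  have hd := hUp.sub huhp.isPrimitive
  have hdL := huhp.memLp_sub_deriv hq.continuous (a - h) (b + h)
  obtain ⟨hH1, hnorm⟩ := memH1_and_normH1_eq hAB.le hd
    (w := fun x => u x - uh x) (huU.mono fun x hx => congrArg (· - uh x) hx) hdL
  refine ⟨hH1, ?_⟩
  set Y := √(∫ x, p x ^ 2) with hY
  have hY0 : 0 ≤ Y := Real.sqrt_nonneg _
  set S := ∫ x in (a - h)..(b + h), (q x - deriv uh x) ^ 2 with hS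
  have hS0 : 0 ≤ S := intervalIntegral.integral_nonneg hAB.le fun x _ => sq_nonneg _
  have hmono : volume.restrict (Ioc (a - h) (b + h)) ≤ volume.restrict (Icc (a - h) (b + h)) :=
    Measure.restrict_mono_set _ Ioc_subset_Icc_self
  have hsplit : S = ∫ x in (a - h)..(b + h), ((q x - deriv v x) + deriv (v - uh) x) ^ 2 := by
    have h1 := (hvp.isPrimitive.sub hep.isPrimitive).ae_deriv_eq
    have h2 : (fun x => v x - (v - uh) x) = uh := by funext x; simp
    rw [h2] at h1
    refine intervalIntegral.integral_congr_ae (h1.mono fun x hx _ => ?_)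
    rw [hx]
    ring
  have hY2 : ∫ x, p x ^ 2 = Y ^ 2 := (Real.sq_sqrt (integral_nonneg fun x => sq_nonneg _)).symm
  have b1 : ∫ x in (a - h)..(b + h), (q x - deriv v x) ^ 2 ≤ h ^ 2 * Y ^ 2 := by
    refine (hvp.integral_interpolation_error_le hh hb hp hq hU hvU).trans
      (mul_le_mul_of_nonneg_left ?_ (sq_nonneg _))
    rw [← hY2, intervalIntegral.integral_of_le hAB.le]
    exact setIntegral_le_integral hp.integrable_sq (.of_forall fun t => sq_nonneg _)
  have b2 : ∫ x in (a - h)..(b + h), deriv (v - uh) x ^ 2 ≤ (24 * N * h * Y) ^ 2 := by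
    rw [intervalIntegral.integral_of_le hAB.le]
    refine (setIntegral_le_integral (hep.memLp_deriv he0).integrable_sq
      (.of_forall fun t => sq_nonneg _)).trans ?_
    rw [← Real.sq_sqrt (integral_nonneg fun x => sq_nonneg (deriv (v - uh) x))]
    exact pow_le_pow_left₀ (Real.sqrt_nonneg _) hX 2
  have bS : S ≤ (2 + 1152 * N ^ 2) * (h * Y) ^ 2 := by
    rw [hsplit]
    refine (integral_add_sq_le hAB.le
      ((hvp.memLp_sub_deriv hq.continuous _ _).mono_measure hmono)
      ((hep.memLp_deriv he0).restrict _)).trans ?_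
    calc _ ≤ 2 * (h ^ 2 * Y ^ 2) + 2 * (24 * N * h * Y) ^ 2 := by linarith
      _ = _ := by ring
  have hd0 : U (a - h) - uh (a - h) = 0 := by
    have e1 : node a h (-1) = a - h := by simp only [node]; push_cast; ring
    have hm : node a h (-1) ∈ interaction a b h := by
      rw [e1]; exact Or.inl ⟨le_rfl, by linarith⟩
    rw [← e1, huh.constraint _ hm, hUg hm, sub_self]
  have bP : ∫ x in (a - h)..(b + h), (U x - uh x) ^ 2 ≤ 9 * (b - a) ^ 2 * S := by
    refine (hd.integral_sq_le hAB.le hd0 (hdL.mono_measure hmono)).trans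
      (mul_le_mul_of_nonneg_right ?_ hS0)
    have h1 : b + h - (a - h) ≤ 3 * (b - a) := by linarith
    calc (b + h - (a - h)) ^ 2 ≤ (3 * (b - a)) ^ 2 := pow_le_pow_left₀ (by linarith) h1 2
      _ = _ := by ring
  rw [hnorm]
  calc _ ≤ √((1 + 9 * (b - a) ^ 2) * (2 + 1152 * N ^ 2) * (h * Y) ^ 2) := by
        refine Real.sqrt_le_sqrt ?_
        have := mul_le_mul_of_nonneg_left bS (show 0 ≤ 1 + 9 * (b - a) ^ 2 by positivity)
        linarith
    _ = √((1 + 9 * (b - a) ^ 2) * (2 + 1152 * N ^ 2)) * Y * h := by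
        rw [Real.sqrt_mul (by positivity), Real.sqrt_sq (by positivity)]; ring
    _ ≤ _ := mul_le_mul_of_nonneg_right
        (mul_le_mul_of_nonneg_left hpY (Real.sqrt_nonneg _)) hh.le

end NonlocalFEM

end

theorem theorem1 (a b : ℝ) (hab : a < b) (N : ℕ) (hN : 0 < N) :
    ∃ C : ℝ, 0 < C ∧
      ∀ (n : ℕ) (h δ : ℝ), 0 < n → h = (b - a) / (n : ℝ) → δ = h →
      ∀ wt : ℝ → ℤ → ℝ,
        (∀ x ∈ NonlocalFEM.wholeDomain a b δ, NonlocalFEM.IsGMLSWeights δ N x (wt x)) →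
      ∀ f g u uh : ℝ → ℝ,
        MemLp f 2 (volume.restrict (Ioo a b)) →
        ContinuousOn g (NonlocalFEM.interaction a b δ) →
        NonlocalFEM.IsNonlocalSolution a b δ f g u →
        NonlocalFEM.MemH2 (Ioo (a - δ) (b + δ)) u →
        NonlocalFEM.IsDiscreteSolution a b δ h N wt f g uh →
        NonlocalFEM.MemH1 (Ioo (a - δ) (b + δ)) (fun x => u x - uh x) ∧
          NonlocalFEM.normH1 (Ioo (a - δ) (b + δ)) (fun x => u x - uh x)
            ≤ C * NonlocalFEM.normH2 (Ioo (a - δ) (b + δ)) u * h := by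
  refine ⟨√((1 + 9 * (b - a) ^ 2) * (2 + 1152 * N ^ 2)), by positivity, ?_⟩
  intro n h δ hn hh hδ wt hwt f g u uh _ hg hu hu2 huh
  subst hδ
  have hn' : (1 : ℝ) ≤ n := by exact_mod_cast hn
  have hpos : 0 < δ := by rw [hh]; exact div_pos (sub_pos.2 hab) (by linarith)
  have hb : b = a + n * δ := by rw [hh]; field_simp; ring
  exact NonlocalFEM.error_estimate hab hpos (by rw [hh]; exact div_le_self (by linarith) hn') hb hN
    hwt hg hu hu2 huh
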